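/- **Setting.** Fix a finite set $E$ of resources, each with a weakly increasing cost function $c_e:\mathbb N\to\mathbb R_+$, and a finite set $T$ of types, each with a nonempty family $\mathcal S_t\subseteq 2^E$ of strategies. *Bernoulli games.* A Bernoulli congestion game $\Gamma_B$ has a finite player set $N$; player $i$ has a type $t_i\in T$ and a participation probability $r_i\in(0,1)$. For a profile $\sigma=(\sigma_i)_{i\in N}$ of mixed strategies $\sigma_i\in\Delta(\mathcal S_{t_i})$, let all the variables $U_i\sim\mathrm{Bernoulli}(r_i)$ and $S_i\sim\sigma_i$ be independent, and put $X_e=\sum_{i}U_i\mathbf 1_{\{e\in S_i\}}$ and $Z_{i,e}=\sum_{j\ne i}U_j\mathbf 1_{\{e\in S_j\}}$. The profile $\sigma$ is a Bayes-Nash equilibrium, $\sigma\in\mathrm{BNE}(\Gamma_B)$, if for all $i\in N$ and $s,s'\in\mathcal S_{t_i}$ with $\sigma_i(s)>0$ one has $\sum_{e\in s}\mathbb E_\sigma[c_e(1+Z_{i,e})]\le\sum_{e\in s'}\mathbb E_\sigma[c_e(1+Z_{i,e})]$. Its expected social cost is $\mathrm{ESC}(\sigma)=\mathbb E_\sigma\big[\sum_{e}X_e\,c_e(X_e)\big]$.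 Let $\mathrm{Opt}(\Gamma_B)=\min_\sigma\mathrm{ESC}(\sigma)$, $\mathrm{PoA}(\Gamma_B)=\max_{\sigma\in\mathrm{BNE}(\Gamma_B)}\mathrm{ESC}(\sigma)/\mathrm{Opt}(\Gamma_B)$ and $\mathrm{PoS}(\Gamma_B)=\min_{\sigma\in\mathrm{BNE}(\Gamma_B)}\mathrm{ESC}(\sigma)/\mathrm{Opt}(\Gamma_B)$. *Assumptions.* Let $\Gamma_B^n$ be a sequence of such games on the same $(E,(c_e),T,(\mathcal S_t))$, with player sets $N^n$, types $t_i^n$ and probabilities $r_i^n$, and let $(d_t)_{t\in T}$ be real numbers such that, as $n\to\infty$, (H3) $|N^n|\to\infty$, $\ \max_{i\in N^n}r_i^n\to0$, and $\ \sum_{i:\,t_i^n=t}r_i^n\to d_t$ for every $t\in T$; (HP) there are $\nu\in\mathbb R$ and $\alpha>\sum_t d_t$ such that, for $V\sim\mathrm{Poisson}(\alpha)$ and every $e\in E$, $\mathbb E\,|\Delta^2c_e(1+V)|\le\nu$, where $\Delta^2c(k)=c(k+2)-2c(k+1)+c(k)$. *Limit game.* Let $\tilde c_e(x)=\mathbb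 E[c_e(1+X)]$ with $X\sim\mathrm{Poisson}(x)$, for $x\ge0$, and let $\tilde\Gamma^\infty$ be the nonatomic congestion game with costs $\tilde c_e$ and demands $d_t$. Its feasible pairs $(y,x)$ are those with $y_{t,s}\ge0$, $\sum_{s\in\mathcal S_t}y_{t,s}=d_t$ and $x_e=\sum_t\sum_{s\in\mathcal S_t}y_{t,s}\mathbf 1_{\{e\in s\}}$; their social cost is $\mathrm{SC}(y,x)=\sum_e x_e\tilde c_e(x_e)$, and $\mathrm{Opt}(\tilde\Gamma^\infty)$ is the minimal social cost. A Wardrop equilibrium is a feasible pair such that $y_{t,s}>0$ implies $\sum_{e\in s}\tilde c_e(x_e)\le\sum_{e\in s'}\tilde c_e(x_e)$ for all $s'\in\mathcal S_t$. Let $\mathrm{Eq}(\tilde\Gamma^\infty)$ be the common social cost of all Wardrop equilibria, and let $\mathrm{PoA}(\tilde\Gamma^\infty)$ and $\mathrm{PoS}(\tilde\Gamma^\infty)$ be the largest and the smallest ratio of the social cost of a Wardrop equilibrium to $\mathrm{Opt}(\tilde\Gamma^\infty)$. **Theorem.** Under (H3) and (HP), these quantities are well defined: $\tilde c_e$ is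 finite on $[0,\sum_t d_t]$; $\tilde\Gamma^\infty$ has an optimum and a Wardrop equilibrium, and all its Wardrop equilibria have the same social cost; and in every $\Gamma_B^n$ there are Bayes-Nash equilibria and the minima and maxima above are attained (with the convention $a/0=0$ if $\mathrm{Opt}(\Gamma_B^n)=0$). Moreover: 1. for every sequence $\hat\sigma^n\in\mathrm{BNE}(\Gamma_B^n)$, $\ \mathrm{ESC}(\hat\sigma^n)\to\mathrm{Eq}(\tilde\Gamma^\infty)$; 2. $\mathrm{Opt}(\Gamma_B^n)\to\mathrm{Opt}(\tilde\Gamma^\infty)$; 3. if $\mathrm{Opt}(\tilde\Gamma^\infty)>0$, then $\mathrm{PoA}(\tilde\Gamma^\infty)=\mathrm{PoS}(\tilde\Gamma^\infty)=\mathrm{Eq}(\tilde\Gamma^\infty)/\mathrm{Opt}(\tilde\Gamma^\infty)$, and both $\mathrm{PoA}(\Gamma_B^n)$ and $\mathrm{PoS}(\Gamma_B^n)$ converge to this number. -/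

import Mathlib

open Filter Topology MeasureTheory ProbabilityTheory
open scoped NNReal

noncomputable section

namespace Congestion

universe u v w

/-- The data shared by all games: a finite set `E` of resources, a finite set `T` of types, a
nonnegative weakly increasing cost function on the integers for every resource, and a nonempty
family of feasible strategies (sets of resources) for every type. -/
structure Structure (E : Type u) (T : Type v) where
  cost : E → ℕ → ℝ
  cost_nonneg : ∀ e k, 0 ≤ cost e k
  cost_mono : ∀ e, Monotone (cost e)
  strat : T → Finset (Finset E)
  strat_nonempty : ∀ t, (strat t).Nonempty

/-! ## Nonatomic congestion games -/

/-- A nonatomic congestion game: strategies, resource costs `ℝ₊ → ℝ` (only their values at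
nonnegative reals matter) and demands. -/
structure NonatomicGame (E : Type u) (T : Type v) where
  strat : T → Finset (Finset E)
  cost : E → ℝ → ℝ
  demand : T → ℝ

namespace NonatomicGame

variable {E : Type u} {T : Type v} [Fintype E] [DecidableEq E] [Fintype T]

/-- Pairs `(y, x)` of a strategy flow and a resource load. -/
abbrev FlowLoad (Γ : NonatomicGame E T) : Type (max u v) :=
  ((t : T) → Γ.strat t → ℝ) × (E → ℝ)

/-- The set of feasible flow-load pairs. -/
def feasible (Γ : NonatomicGame E T) : Set Γ.FlowLoad :=
  {p | (∀ t s, 0 ≤ p.1 t s) ∧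
    (∀ t, Γ.demand t = ∑ s : Γ.strat t, p.1 t s) ∧
    (∀ e, p.2 e = ∑ t : T, ∑ s : Γ.strat t, if e ∈ s.1 then p.1 t s else 0)}

/-- The set of Wardrop equilibria. -/
def wardrop (Γ : NonatomicGame E T) : Set Γ.FlowLoad :=
  {p | p ∈ Γ.feasible ∧ ∀ t, ∀ s s' : Γ.strat t, 0 < p.1 t s →
    ∑ e ∈ s.1, Γ.cost e (p.2 e) ≤ ∑ e ∈ s'.1, Γ.cost e (p.2 e)}

/-- The social cost of a flow-load pair. -/
def socialCost (Γ : NonatomicGame E T) (p : Γ.FlowLoad) : ℝ :=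
  ∑ e : E, p.2 e * Γ.cost e (p.2 e)

/-- The optimal social cost. -/
def opt (Γ : NonatomicGame E T) : ℝ := sInf (Γ.socialCost '' Γ.feasible)

/-- The equilibrium cost: the social cost of Wardrop equilibria (when it is the same for
all of them). -/
def eqCost (Γ : NonatomicGame E T) : ℝ := sSup (Γ.socialCost '' Γ.wardrop)

/-- The price of anarchy. -/
def poa (Γ : NonatomicGame E T) : ℝ := sSup ((fun p => Γ.socialCost p / Γ.opt) '' Γ.wardrop)

/-- The price of stability. -/
def pos (Γ : NonatomicGame E T) : ℝ := sInf ((fun p => Γ.socialCost p / Γ.opt) '' Γ.wardrop)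

end NonatomicGame

/-! ## Bernoulli congestion games -/

/-- A Bernoulli congestion game: a finite set of players, where player `i` has type `typ i` and
takes part in the game with probability `part i`. -/
structure BernoulliGame {E : Type u} {T : Type v} (G : Structure E T) where
  Player : Type w
  [fintypePlayer : Fintype Player]
  [decEqPlayer : DecidableEq Player]
  part : Player → ℝ
  part_mem : ∀ i, part i ∈ Set.Ioo (0 : ℝ) 1
  typ : Player → T

attribute [instance] BernoulliGame.fintypePlayer BernoulliGame.decEqPlayer

namespace BernoulliGame

variable {E : Type u} {T : Type v} [Fintype E] [DecidableEq E] [DecidableEq T]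
variable {G : Structure E T}

/-- The strategies available to player `i`. -/
abbrev Strat (Γ : BernoulliGame.{u, v, w} G) (i : Γ.Player) : Type u := G.strat (Γ.typ i)

/-- Mixed strategy profiles: one probability vector per player. -/
abbrev Profile (Γ : BernoulliGame.{u, v, w} G) : Type (max u w) :=
  (i : Γ.Player) → stdSimplex ℝ (Γ.Strat i)

/-- Outcomes `(u, s)`: `u i` tells whether player `i` is active, `s i` is her pure strategy. -/
abbrev Outcome (Γ : BernoulliGame.{u, v, w} G) : Type (max u w) :=
  (Γ.Player → Bool) × ((i : Γ.Player) → Γ.Strat i)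

/-- The probability of an outcome: participation and strategies are all independent. -/
def prob (Γ : BernoulliGame.{u, v, w} G) (σ : Γ.Profile) (ω : Γ.Outcome) : ℝ :=
  ∏ i, (if ω.1 i then Γ.part i else 1 - Γ.part i) * (σ i).1 (ω.2 i)

/-- The expectation of a random variable under the profile `σ`. -/
def expect (Γ : BernoulliGame.{u, v, w} G) (σ : Γ.Profile) (f : Γ.Outcome → ℝ) : ℝ :=
  ∑ ω : Γ.Outcome, Γ.prob σ ω * f ω

/-- The random load `X_e`: the number of active players that use `e`. -/
def load (Γ : BernoulliGame.{u, v, w} G) (e : E) (ω : Γ.Outcome) : ℕ :=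
  ∑ j, if ω.1 j ∧ e ∈ (ω.2 j).1 then 1 else 0

/-- The random load `Z_{i,e}`: the number of active players other than `i` that use `e`. -/
def loadExcept (Γ : BernoulliGame.{u, v, w} G) (i : Γ.Player) (e : E) (ω : Γ.Outcome) : ℕ :=
  ∑ j ∈ Finset.univ.erase i, if ω.1 j ∧ e ∈ (ω.2 j).1 then 1 else 0

/-- The set of Bayes-Nash equilibria. -/
def bne (Γ : BernoulliGame.{u, v, w} G) : Set Γ.Profile :=
  {σ | ∀ i, ∀ s s' : Γ.Strat i, 0 < (σ i).1 s →
    ∑ e ∈ s.1, Γ.expect σ (fun ω => G.cost e (1 + Γ.loadExcept i e ω)) ≤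
      ∑ e ∈ s'.1, Γ.expect σ (fun ω => G.cost e (1 + Γ.loadExcept i e ω))}

/-- The expected social cost. -/
def esc (Γ : BernoulliGame.{u, v, w} G) (σ : Γ.Profile) : ℝ :=
  Γ.expect σ (fun ω => ∑ e : E, (Γ.load e ω : ℝ) * G.cost e (Γ.load e ω))

/-- The optimal expected social cost. -/
def opt (Γ : BernoulliGame.{u, v, w} G) : ℝ := sInf (Set.range Γ.esc)

/-- The price of anarchy (worst equilibrium). -/
def poa (Γ : BernoulliGame.{u, v, w} G) : ℝ := sSup ((fun σ => Γ.esc σ / Γ.opt) '' Γ.bne)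

/-- The price of stability (best equilibrium). -/
def pos (Γ : BernoulliGame.{u, v, w} G) : ℝ := sInf ((fun σ => Γ.esc σ / Γ.opt) '' Γ.bne)

/-- The expected demand of type `t`. -/
def demand (Γ : BernoulliGame.{u, v, w} G) (t : T) : ℝ :=
  ∑ i with Γ.typ i = t, Γ.part i

/-- The largest participation probability. -/
def maxPart (Γ : BernoulliGame.{u, v, w} G) : ℝ := ⨆ i, Γ.part i

end BernoulliGame

/-! ## The limit game and the asymptotic assumptions -/

section Limit

variable {E : Type u} {T : Type v}

/-- The auxiliary cost `x ↦ 𝔼[c_e(1 + X)]` with `X ∼ Poisson(x)`, for `x ≥ 0`. -/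
def auxCost (G : Structure E T) (e : E) (x : ℝ) : ℝ :=
  ∫ k, G.cost e (1 + k) ∂(poissonMeasure x.toNNReal)

/-- The nonatomic limit game with the auxiliary costs and demands `d`. -/
def limitGame (G : Structure E T) (d : T → ℝ) : NonatomicGame E T where
  strat := G.strat
  cost := auxCost G
  demand := d

/-- The number of players tends to infinity, the participation probabilities tend uniformly to
zero, and the expected demand of every type `t` tends to `d t`. -/
structure AsymptoticallyPoisson [DecidableEq T] {G : Structure E T}
    (Γ : ℕ → BernoulliGame.{u, v, w} G) (d : T → ℝ) : Prop where
  card_tendsto : Tendsto (fun n => Fintype.card (Γ n).Player) atTop atTop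
  maxPart_tendsto : Tendsto (fun n => (Γ n).maxPart) atTop (𝓝 0)
  demand_tendsto : ∀ t, Tendsto (fun n => (Γ n).demand t) atTop (𝓝 (d t))

/-- The second difference `Δ²c(k) = c(k+2) - 2 c(k+1) + c(k)`. -/
def secondDiff (c : ℕ → ℝ) (k : ℕ) : ℝ := c (k + 2) - 2 * c (k + 1) + c k

/-- For some `ν` and some `α > ∑ d_t`, one has `𝔼|Δ²c_e(1 + V)| ≤ ν` for every resource `e`, where
`V ∼ Poisson(α)`. -/
def PoissonMoment [Fintype T] (G : Structure E T) (d : T → ℝ) : Prop :=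
  ∃ (ν : ℝ) (α : ℝ≥0), ∑ t, d t < α ∧ ∀ e,
    Integrable (fun k => |secondDiff (G.cost e) (1 + k)|) (poissonMeasure α) ∧
    ∫ k, |secondDiff (G.cost e) (1 + k)| ∂(poissonMeasure α) ≤ ν

end Limit

end Congestion

end

namespace Congestion

/-! ## Poisson-binomial expectations -/

/-! By independence, the number of active users of a resource in a Bernoulli game is a sum of
independent Bernoulli variables, so every expected cost is a Poisson-binomial expectation `pbExp`
(`expect_count`). When the success probabilities vanish uniformly and their sum tends to x, these
laws converge pointwise to Poisson(x). If moreover x < α, they are eventually dominated by the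
weights α^k/k!, so expectations of functions integrable under Poisson(α) converge (`tendsto_pbExp`).
The moment condition makes k ↦ c_e(1 + k) such a function: integrability passes from second
differences to the costs.

Expected flows of arbitrary profiles stay in a compact box. Along a subsequence with convergent
flows, the expected social cost tends to the social cost of the limit flow (`tendsto_esc`), and
limits of Bayes-Nash equilibria are Wardrop equilibria (`flowLoad_mem_wardrop`), since removing one
player changes loads by a vanishing amount. Conversely, every feasible limit flow is approached by
type-symmetric profiles (`exists_tendsto_flow`), which gives the optimum.

Finite equilibria exist by minimising a potential, and Wardrop equilibria are then obtained as their
limits. Monotone costs make the Wardrop cost unique, so all subsequential limits agree and full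
sequences converge. -/

theorem prod_one_sub_le_exp {ι : Type*} (A : Finset ι) {p : ι → ℝ} (h1 : ∀ i, p i ≤ 1) :
    ∏ i ∈ A, (1 - p i) ≤ Real.exp (-∑ i ∈ A, p i) := by
  rw [← Finset.sum_neg_distrib, Real.exp_sum]
  exact Finset.prod_le_prod (fun i _ => sub_nonneg.2 (h1 i))
    fun i _ => by linarith [Real.add_one_le_exp (-p i)]

/-- Factor by factor, 1/(1 - p) = 1 + p/(1 - p) ≤ exp(p/(1 - p)) ≤ exp(p/(1 - M)). -/
theorem exp_le_prod_one_sub {ι : Type*} (A : Finset ι) {p : ι → ℝ} (h0 : ∀ i, 0 ≤ p i) {M : ℝ}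
    (hM : ∀ i ∈ A, p i ≤ M) (hM1 : M < 1) :
    Real.exp (-((∑ i ∈ A, p i) / (1 - M))) ≤ ∏ i ∈ A, (1 - p i) := by
  have hM1' : 0 < 1 - M := sub_pos.2 hM1
  rw [Finset.sum_div, ← Finset.sum_neg_distrib, Real.exp_sum]
  refine Finset.prod_le_prod (fun i _ => (Real.exp_pos _).le) fun i hi => ?_
  have hi1 : 0 < 1 - p i := by linarith [hM i hi]
  have h3 : p i / (1 - p i) ≤ p i / (1 - M) :=
    div_le_div_of_nonneg_left (h0 i) hM1' (by linarith [hM i hi])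
  have h4 := Real.add_one_le_exp (p i / (1 - p i))
  have h5 : p i / (1 - p i) + 1 = (1 - p i)⁻¹ := by field_simp; ring
  rw [h5] at h4
  rw [Real.exp_neg]
  exact inv_le_of_inv_le₀ hi1 (h4.trans (Real.exp_le_exp.2 h3))

section PoissonBinomial

variable {ι : Type*} [DecidableEq ι]

/-- The expectation of `f` at the number of successes among independent Bernoulli trials indexed
by `A`, with success probabilities `p`. -/
noncomputable def pbExp (A : Finset ι) (p : ι → ℝ) (f : ℕ → ℝ) : ℝ :=
  ∑ B ∈ A.powerset, (∏ i ∈ B, p i) * (∏ i ∈ A \ B, (1 - p i)) * f B.card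

/-- The probability of exactly `k` successes. -/
noncomputable def pbPmf (A : Finset ι) (p : ι → ℝ) (k : ℕ) : ℝ :=
  pbExp A p (fun m => if m = k then 1 else 0)

theorem pbExp_empty (p : ι → ℝ) (f : ℕ → ℝ) : pbExp ∅ p f = f 0 := by
  simp [pbExp]

/-- Conditioning on the outcome of trial `a`. -/
theorem pbExp_insert {A : Finset ι} {a : ι} (ha : a ∉ A) (p : ι → ℝ) (f : ℕ → ℝ) :
    pbExp (insert a A) p f = (1 - p a) * pbExp A p f + p a * pbExp A p (fun k => f (k + 1)) := by
  unfold pbExp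
  rw [Finset.sum_powerset_insert ha, Finset.mul_sum, Finset.mul_sum]
  congr 1
  · refine Finset.sum_congr rfl fun B hB => ?_
    have hB' := Finset.mem_powerset.1 hB
    have haB : a ∉ B := fun h => ha (hB' h)
    rw [Finset.insert_sdiff_of_notMem _ haB, Finset.prod_insert (by simp [ha])]
    ring
  · refine Finset.sum_congr rfl fun B hB => ?_
    have hB' := Finset.mem_powerset.1 hB
    have haB : a ∉ B := fun h => ha (hB' h)
    rw [Finset.prod_insert haB, Finset.card_insert_of_notMem haB,
      Finset.insert_sdiff_insert, Finset.sdiff_insert_of_notMem ha]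
    ring

theorem pbExp_erase {A : Finset ι} {a : ι} (ha : a ∈ A) (p : ι → ℝ) (f : ℕ → ℝ) :
    pbExp A p f = (1 - p a) * pbExp (A.erase a) p f +
      p a * pbExp (A.erase a) p (fun k => f (k + 1)) := by
  conv_lhs => rw [← Finset.insert_erase ha]
  exact pbExp_insert (Finset.notMem_erase a A) p f

theorem pbExp_sub (A : Finset ι) (p : ι → ℝ) (f g : ℕ → ℝ) :
    pbExp A p (fun k => f k - g k) = pbExp A p f - pbExp A p g := by
  simp only [pbExp, ← Finset.sum_sub_distrib, mul_sub]

theorem pbExp_const_mul (A : Finset ι) (p : ι → ℝ) (c : ℝ) (f : ℕ → ℝ) :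
    pbExp A p (fun k => c * f k) = c * pbExp A p f := by
  simp only [pbExp, Finset.mul_sum]
  exact Finset.sum_congr rfl fun B _ => by ring

theorem pbExp_congr_prob (A : Finset ι) {p q : ι → ℝ} (h : ∀ i ∈ A, p i = q i) (f : ℕ → ℝ) :
    pbExp A p f = pbExp A q f := by
  unfold pbExp
  refine Finset.sum_congr rfl fun B hB => ?_
  have hB' := Finset.mem_powerset.1 hB
  congr 2
  · exact Finset.prod_congr rfl fun i hi => h i (hB' hi)
  · exact Finset.prod_congr rfl fun i hi => by rw [h i (Finset.mem_sdiff.1 hi).1]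

theorem pbExp_mono (A : Finset ι) {p : ι → ℝ} (h0 : ∀ i, 0 ≤ p i) (h1 : ∀ i, p i ≤ 1)
    {f g : ℕ → ℝ} (hfg : ∀ k, f k ≤ g k) : pbExp A p f ≤ pbExp A p g :=
  Finset.sum_le_sum fun _ _ => mul_le_mul_of_nonneg_left (hfg _)
    (mul_nonneg (Finset.prod_nonneg fun i _ => h0 i)
      (Finset.prod_nonneg fun i _ => sub_nonneg.2 (h1 i)))

theorem pbExp_const (A : Finset ι) (p : ι → ℝ) (c : ℝ) : pbExp A p (fun _ => c) = c := by
  induction A using Finset.induction_on with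
  | empty => exact pbExp_empty _ _
  | insert a A ha ih => rw [pbExp_insert ha, ih]; ring

/-- Size biasing of the number of successes. -/
theorem pbExp_size_bias (A : Finset ι) (p : ι → ℝ) (f : ℕ → ℝ) :
    pbExp A p (fun k => k * f k) = ∑ i ∈ A, p i * pbExp (A.erase i) p (fun k => f (k + 1)) := by
  induction A using Finset.induction_on generalizing f with
  | empty => simp [pbExp_empty]
  | insert a A ha ih =>
    -- The first summand is handled by the induction hypothesis for the shifted function; the second
    -- becomes the term i = a of the new sum.
    have hsplit : pbExp A p (fun k => ((k + 1 : ℕ) : ℝ) * f (k + 1)) =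
        pbExp A p (fun k => k * f (k + 1)) + pbExp A p (fun k => f (k + 1)) := by
      simp only [pbExp, ← Finset.sum_add_distrib]
      exact Finset.sum_congr rfl fun B _ => by push_cast; ring
    rw [pbExp_insert ha, ih, hsplit, ih (fun k => f (k + 1)), Finset.sum_insert ha,
      Finset.erase_insert ha]
    have : ∀ i ∈ A, p i * pbExp ((insert a A).erase i) p (fun k => f (k + 1)) =
        (1 - p a) * (p i * pbExp (A.erase i) p (fun k => f (k + 1))) +
          p a * (p i * pbExp (A.erase i) p (fun k => f (k + 1 + 1))) := by
      intro i hi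
      have hia : a ≠ i := fun h => ha (h ▸ hi)
      rw [Finset.erase_insert_of_ne hia, pbExp_insert (by simp [ha])]
      ring
    rw [Finset.sum_congr rfl this, Finset.sum_add_distrib, ← Finset.mul_sum, ← Finset.mul_sum]
    ring

theorem pbPmf_nonneg (A : Finset ι) {p : ι → ℝ} (h0 : ∀ i, 0 ≤ p i) (h1 : ∀ i, p i ≤ 1) (k : ℕ) :
    0 ≤ pbPmf A p k := by
  rw [← pbExp_const A p 0]
  exact pbExp_mono A h0 h1 fun m => by split_ifs <;> norm_num

theorem pbPmf_le_one (A : Finset ι) {p : ι → ℝ} (h0 : ∀ i, 0 ≤ p i) (h1 : ∀ i, p i ≤ 1) (k : ℕ) :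
    pbPmf A p k ≤ 1 := by
  rw [← pbExp_const A p 1]
  exact pbExp_mono A h0 h1 fun m => by split_ifs <;> norm_num

/-- Rewriting the finite expectation as a series over ℕ puts different player sets on a common index
set, ready for dominated convergence. -/
theorem hasSum_pbPmf_mul (A : Finset ι) (p : ι → ℝ) (f : ℕ → ℝ) :
    HasSum (fun k => pbPmf A p k * f k) (pbExp A p f) := by
  simp only [pbPmf, pbExp, Finset.sum_mul]
  refine hasSum_sum fun B _ => ?_
  convert hasSum_ite_eq B.card
    ((∏ i ∈ B, p i) * (∏ i ∈ A \ B, (1 - p i)) * f B.card) using 2 with k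
  by_cases h : k = B.card
  · simp [h]
  · simp [h, Ne.symm h]

theorem pbPmf_zero (A : Finset ι) (p : ι → ℝ) : pbPmf A p 0 = ∏ i ∈ A, (1 - p i) := by
  unfold pbPmf
  induction A using Finset.induction_on with
  | empty => simp [pbExp_empty]
  | insert a A ha ih =>
    rw [pbExp_insert ha, ih, Finset.prod_insert ha]
    simp [pbExp_const]

theorem pbPmf_erase_succ {A : Finset ι} {a : ι} (ha : a ∈ A) (p : ι → ℝ) (k : ℕ) :
    pbPmf A p (k + 1) = (1 - p a) * pbPmf (A.erase a) p (k + 1) + p a * pbPmf (A.erase a) p k := by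
  unfold pbPmf
  rw [pbExp_erase ha]
  simp

theorem pbPmf_erase_zero {A : Finset ι} {a : ι} (ha : a ∈ A) (p : ι → ℝ) :
    pbPmf A p 0 = (1 - p a) * pbPmf (A.erase a) p 0 := by
  rw [pbPmf_zero, pbPmf_zero, Finset.mul_prod_erase A (fun i => 1 - p i) ha]

/-- Size biasing applied to the indicator of k + 1. This is the counterpart of the Poisson recursion
(k + 1) P(k + 1) = x P(k). -/
theorem succ_mul_pbPmf_succ (A : Finset ι) (p : ι → ℝ) (k : ℕ) :
    (k + 1) * pbPmf A p (k + 1) = ∑ i ∈ A, p i * pbPmf (A.erase i) p k := by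
  have := pbExp_size_bias A p (fun m => if m = k + 1 then 1 else 0)
  simp only [add_left_inj] at this
  unfold pbPmf
  rw [← this, ← pbExp_const_mul]
  congr 1
  ext m
  split_ifs with h
  · simp [h]
  · simp

theorem one_sub_mul_pbPmf_erase_le {A : Finset ι} {a : ι} (ha : a ∈ A) {p : ι → ℝ}
    (h0 : ∀ i, 0 ≤ p i) (h1 : ∀ i, p i ≤ 1) (k : ℕ) :
    (1 - p a) * pbPmf (A.erase a) p k ≤ pbPmf A p k := by
  cases k with
  | zero => rw [pbPmf_erase_zero ha]
  | succ k =>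
    rw [pbPmf_erase_succ ha]
    have := mul_nonneg (h0 a) (pbPmf_nonneg (A.erase a) h0 h1 k)
    linarith

/-- Conditioning on trial `a`, the difference is p_a times a difference of two probabilities. -/
theorem abs_pbPmf_erase_sub_le {A : Finset ι} {a : ι} (ha : a ∈ A) {p : ι → ℝ}
    (h0 : ∀ i, 0 ≤ p i) (h1 : ∀ i, p i ≤ 1) (k : ℕ) :
    |pbPmf (A.erase a) p k - pbPmf A p k| ≤ p a := by
  have hk := pbPmf_nonneg (A.erase a) h0 h1 k
  have hk' := pbPmf_le_one (A.erase a) h0 h1 k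
  have ha0 := h0 a
  cases k with
  | zero =>
    rw [pbPmf_erase_zero ha, abs_le]
    constructor <;> nlinarith
  | succ k =>
    have hj := pbPmf_nonneg (A.erase a) h0 h1 k
    have hj' := pbPmf_le_one (A.erase a) h0 h1 k
    rw [pbPmf_erase_succ ha, abs_le]
    constructor <;> nlinarith

/-- The probability of `k` successes is at most a multiple of the Poisson probability. -/
theorem pbPmf_le_pow_div_factorial (A : Finset ι) {p : ι → ℝ} (h0 : ∀ i, 0 ≤ p i)
    (h1 : ∀ i, p i ≤ 1) {M β : ℝ} (hM : ∀ i ∈ A, p i ≤ M)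
    (hβ : ∑ i ∈ A, p i ≤ β * (1 - M)) (hM1 : M < 1) (k : ℕ) :
    pbPmf A p k ≤ β ^ k / k.factorial := by
  have hM1' : 0 < 1 - M := sub_pos.2 hM1
  have hβ0 : 0 ≤ β := by
    have : 0 ≤ β * (1 - M) := (Finset.sum_nonneg fun i _ => h0 i).trans hβ
    exact nonneg_of_mul_nonneg_left this hM1'
  induction k with
  | zero => simpa using pbPmf_le_one A h0 h1 0
  | succ k ih =>
    -- In the size-biased recursion, restoring the missing trial costs at most a factor 1/(1 - M);
    -- the hypothesis on β absorbs exactly this factor.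
    have key : (1 - M) * ((k + 1) * pbPmf A p (k + 1)) ≤ (β * (1 - M)) * pbPmf A p k := by
      rw [succ_mul_pbPmf_succ, Finset.mul_sum]
      refine le_trans (Finset.sum_le_sum (g := fun i => p i * pbPmf A p k) fun i hi => ?_) ?_
      · have h2 := one_sub_mul_pbPmf_erase_le hi h0 h1 k
        have h3 := pbPmf_nonneg (A.erase i) h0 h1 k
        have h4 := hM i hi
        calc (1 - M) * (p i * pbPmf (A.erase i) p k)
            = p i * ((1 - M) * pbPmf (A.erase i) p k) := by ring
          _ ≤ p i * pbPmf A p k := by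
              refine mul_le_mul_of_nonneg_left (le_trans ?_ h2) (h0 i)
              exact mul_le_mul_of_nonneg_right (by linarith) h3
      · rw [← Finset.sum_mul]
        exact mul_le_mul_of_nonneg_right hβ (pbPmf_nonneg A h0 h1 k)
    have key2 : (k + 1) * pbPmf A p (k + 1) ≤ β * pbPmf A p k := by
      refine le_of_mul_le_mul_left ?_ hM1'
      calc _ ≤ _ := key
        _ = _ := by ring
    rw [Nat.factorial_succ, pow_succ, le_div_iff₀ (by positivity)]
    rw [le_div_iff₀ (by positivity)] at ih
    push_cast
    have hf : (0 : ℝ) < k.factorial := by positivity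
    calc pbPmf A p (k + 1) * ((k + 1) * k.factorial)
        = ((k + 1) * pbPmf A p (k + 1)) * k.factorial := by ring
      _ ≤ (β * pbPmf A p k) * k.factorial := mul_le_mul_of_nonneg_right key2 hf.le
      _ = β * (pbPmf A p k * k.factorial) := by ring
      _ ≤ β * β ^ k := mul_le_mul_of_nonneg_left ih hβ0
      _ = β ^ k * β := mul_comm _ _

/-- Restoring trial i in the i-th term of the size-biased recursion costs at most p_i · p_i ≤ M p_i.
-/
theorem abs_succ_mul_pbPmf_succ_sub_le (A : Finset ι) {p : ι → ℝ} (h0 : ∀ i, 0 ≤ p i)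
    (h1 : ∀ i, p i ≤ 1) {M : ℝ} (hM : ∀ i ∈ A, p i ≤ M) (k : ℕ) :
    |(k + 1) * pbPmf A p (k + 1) - (∑ i ∈ A, p i) * pbPmf A p k| ≤ M * ∑ i ∈ A, p i := by
  rw [succ_mul_pbPmf_succ, Finset.sum_mul, ← Finset.sum_sub_distrib, Finset.mul_sum]
  refine (Finset.abs_sum_le_sum_abs _ _).trans (Finset.sum_le_sum fun i hi => ?_)
  rw [← mul_sub, abs_mul, abs_of_nonneg (h0 i), mul_comm M]
  exact mul_le_mul_of_nonneg_left ((abs_pbPmf_erase_sub_le hi h0 h1 k).trans (hM i hi)) (h0 i)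

end PoissonBinomial

/-! ## The Poisson limit -/

section PoissonLimit

variable {ι : ℕ → Type*} [∀ n, DecidableEq (ι n)] {A : ∀ n, Finset (ι n)} {p : ∀ n, ι n → ℝ}
  {M : ℕ → ℝ} {x : ℝ}

/-- Induction on k: the case 0 squeezes the product of the 1 - p_i between exponentials, and the
successor step passes to the limit in the approximate Poisson recursion. -/
theorem tendsto_pbPmf (h0 : ∀ n i, 0 ≤ p n i) (h1 : ∀ n i, p n i ≤ 1)
    (hM : ∀ n, ∀ i ∈ A n, p n i ≤ M n) (hM0 : Tendsto M atTop (𝓝 0))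
    (hS : Tendsto (fun n => ∑ i ∈ A n, p n i) atTop (𝓝 x)) (k : ℕ) :
    Tendsto (fun n => pbPmf (A n) (p n) k) atTop
      (𝓝 (Real.exp (-x) * x ^ k / k.factorial)) := by
  induction k with
  | zero =>
    simp only [pbPmf_zero, pow_zero, Nat.factorial_zero, Nat.cast_one, mul_one, div_one]
    have hl : Tendsto (fun n => Real.exp (-((∑ i ∈ A n, p n i) / (1 - M n)))) atTop
        (𝓝 (Real.exp (-x))) := by
      have : Tendsto (fun n => (∑ i ∈ A n, p n i) / (1 - M n)) atTop (𝓝 (x / (1 - 0))) :=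
        hS.div (tendsto_const_nhds.sub hM0) (by norm_num)
      rw [sub_zero, div_one] at this
      exact (Real.continuous_exp.tendsto _).comp this.neg
    refine tendsto_of_tendsto_of_tendsto_of_le_of_le' hl
      ((Real.continuous_exp.tendsto _).comp hS.neg) ?_
      (Eventually.of_forall fun n => prod_one_sub_le_exp _ (h1 n))
    filter_upwards [hM0.eventually_lt_const one_pos] with n hn
    exact exp_le_prod_one_sub _ (h0 n) (hM n) hn
  | succ k ih =>
    have hdiff : Tendsto (fun n => (k + 1) * pbPmf (A n) (p n) (k + 1) -
        (∑ i ∈ A n, p n i) * pbPmf (A n) (p n) k) atTop (𝓝 0) := by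
      refine squeeze_zero_norm (a := fun n => M n * ∑ i ∈ A n, p n i)
        (fun n => abs_succ_mul_pbPmf_succ_sub_le _ (h0 n) (h1 n) (hM n) k) ?_
      simpa using hM0.mul hS
    have h2 := ((hdiff.add (hS.mul ih)).div_const ((k : ℝ) + 1))
    have hk : (k : ℝ) + 1 ≠ 0 := by positivity
    convert h2 using 2 with n
    · field_simp; ring
    · rw [Nat.factorial_succ]; push_cast; field_simp; ring

theorem integrable_poissonMeasure_iff_summable {r : ℝ≥0} {f : ℕ → ℝ} :
    Integrable f (poissonMeasure r) ↔
      Summable (fun n => (r : ℝ) ^ n / n.factorial * |f n|) := by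
  rw [integrable_poissonMeasure_iff, ← summable_mul_left_iff (Real.exp_pos (-(r : ℝ))).ne'
    (f := fun n => (r : ℝ) ^ n / n.factorial * |f n|)]
  refine summable_congr fun n => ?_
  rw [Real.norm_eq_abs]; ring

/-- The Poisson limit theorem for expectations of functions integrable at a larger rate. -/
theorem tendsto_pbExp (h0 : ∀ n i, 0 ≤ p n i) (h1 : ∀ n i, p n i ≤ 1)
    (hM : ∀ n, ∀ i ∈ A n, p n i ≤ M n) (hM0 : Tendsto M atTop (𝓝 0))
    (hS : Tendsto (fun n => ∑ i ∈ A n, p n i) atTop (𝓝 x)) {α : ℝ≥0} (hα : x < α)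
    {f : ℕ → ℝ} (hf : Integrable f (poissonMeasure α)) :
    Tendsto (fun n => pbExp (A n) (p n) f) atTop
      (𝓝 (∫ k, f k ∂(poissonMeasure x.toNNReal))) := by
  have hx : 0 ≤ x := ge_of_tendsto' hS fun n => Finset.sum_nonneg fun i _ => h0 n i
  rw [integrable_poissonMeasure_iff_summable] at hf
  rw [integral_poissonMeasure]
  simp only [Real.coe_toNNReal x hx, smul_eq_mul]
  simp only [← (hasSum_pbPmf_mul _ _ f).tsum_eq]
  refine tendsto_tsum_of_dominated_convergence hf
    (fun k => (tendsto_pbPmf h0 h1 hM hM0 hS k).mul_const _) ?_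
  -- The gap x < α ensures that eventually ∑ p ≤ α(1 - M), which is the condition for the domination
  -- by α^k/k! with β = α.
  have hlim : Tendsto (fun n => α * (1 - M n) - ∑ i ∈ A n, p n i) atTop (𝓝 (α * (1 - 0) - x)) :=
    ((tendsto_const_nhds.sub hM0).const_mul _).sub hS
  filter_upwards [hM0.eventually_lt_const one_pos,
    hlim.eventually_const_lt (u := 0) (by simpa using hα)] with n hn1 hn2 k
  rw [norm_mul, Real.norm_eq_abs, Real.norm_eq_abs, abs_of_nonneg (pbPmf_nonneg _ (h0 n) (h1 n) k)]
  exact mul_le_mul_of_nonneg_right (pbPmf_le_pow_div_factorial _ (h0 n) (h1 n) (hM n)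
    (by linarith) hn1 k) (abs_nonneg _)

end PoissonLimit

/-! ## Integrability and monotonicity of Poisson expectations -/

/-- Summing the recursion bounds a partial sum of the tail by u(K) plus half of itself plus ∑ v. -/
theorem summable_of_eventually_le_half_add {u v : ℕ → ℝ} (hu : ∀ k, 0 ≤ u k) (hv : Summable v)
    (hv0 : ∀ k, 0 ≤ v k) (h : ∀ᶠ k in atTop, u (k + 1) ≤ u k / 2 + v k) : Summable u := by
  obtain ⟨K, hK⟩ := eventually_atTop.1 h
  rw [← summable_nat_add_iff K]
  have hv' : Summable fun k => v (k + K) := (summable_nat_add_iff K).2 hv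
  refine summable_of_sum_range_le (c := 2 * (u K + ∑' k, v (k + K))) (fun k => hu _) fun n => ?_
  have h1 : ∑ k ∈ Finset.range (n + 1), u (k + K) ≤
      u K + (∑ k ∈ Finset.range n, u (k + K)) / 2 + ∑ k ∈ Finset.range n, v (k + K) := by
    rw [Finset.sum_range_succ', Finset.sum_div, add_assoc (u K), ← Finset.sum_add_distrib,
      zero_add, add_comm]
    gcongr with k
    rw [add_right_comm]
    exact hK _ (Nat.le_add_left _ _)
  have h2 := hv'.sum_le_tsum (Finset.range n) fun k _ => hv0 _
  have h3 := hu (n + K)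
  rw [Finset.sum_range_succ] at h1
  linarith

/-- The weights α^k/k! have ratio α/(k + 1), eventually at most 1/2, and |g(k + 1)| ≤ |g(k)| + |g(k
+ 1) - g(k)|; so the weighted values of |g| satisfy a halving recursion with summable error. -/
theorem integrable_of_integrable_forward_diff {α : ℝ≥0} {g : ℕ → ℝ}
    (h : Integrable (fun k => g (k + 1) - g k) (poissonMeasure α)) :
    Integrable g (poissonMeasure α) := by
  rw [integrable_poissonMeasure_iff_summable] at h ⊢
  refine summable_of_eventually_le_half_add (fun k => by positivity) h (fun k => by positivity) ?_
  obtain ⟨K, hK⟩ := exists_nat_gt (2 * (α : ℝ))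
  filter_upwards [eventually_ge_atTop K] with k hk
  have hkK : (K : ℝ) ≤ k := by exact_mod_cast hk
  set a : ℝ := (α : ℝ) ^ k / k.factorial with ha
  have ha0 : 0 ≤ a := by positivity
  have hα : (0 : ℝ) ≤ α := α.2
  have hs : (α : ℝ) ^ (k + 1) / (k + 1).factorial = a * (α / (k + 1)) := by
    rw [ha, Nat.factorial_succ, pow_succ]; push_cast; field_simp
  have hle : (α : ℝ) / (k + 1) ≤ 1 / 2 := by
    rw [div_le_iff₀ (by positivity)]; linarith
  have habs : |g (k + 1)| ≤ |g k| + |g (k + 1) - g k| := by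
    have := abs_add_le (g k) (g (k + 1) - g k)
    rwa [add_sub_cancel] at this
  rw [hs]
  calc a * (α / (k + 1)) * |g (k + 1)| ≤ a * (1 / 2) * (|g k| + |g (k + 1) - g k|) := by gcongr
    _ ≤ a * |g k| / 2 + a * |g (k + 1) - g k| := by
      have := mul_nonneg ha0 (abs_nonneg (g (k + 1) - g k))
      linarith

theorem integrable_poissonMeasure_of_le {r s : ℝ≥0} (hrs : r ≤ s) {f : ℕ → ℝ}
    (hf : Integrable f (poissonMeasure s)) : Integrable f (poissonMeasure r) := by
  rw [integrable_poissonMeasure_iff_summable] at hf ⊢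
  refine hf.of_nonneg_of_le (fun k => by positivity) fun k => ?_
  gcongr

/-- Coupling: Poisson(r + h) is the law of the sum of independent Poisson(r) and Poisson(h)
variables, and f can only grow when the second one is added. -/
theorem integral_poissonMeasure_mono {r s : ℝ≥0} (hrs : r ≤ s) {f : ℕ → ℝ} (hmono : Monotone f)
    (hf : Integrable f (poissonMeasure s)) :
    ∫ k, f k ∂(poissonMeasure r) ≤ ∫ k, f k ∂(poissonMeasure s) := by
  obtain ⟨h, rfl⟩ := exists_add_of_le hrs
  have hr := integrable_poissonMeasure_of_le hrs hf
  rw [← poissonMeasure_conv_poissonMeasure, Measure.conv] at hf ⊢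
  have hadd : Measurable fun z : ℕ × ℕ => z.1 + z.2 := Measurable.of_discrete
  rw [integral_map hadd.aemeasurable Measurable.of_discrete.aestronglyMeasurable]
  have hfst := integral_fun_fst (μ := poissonMeasure r) (ν := poissonMeasure h) f
  rw [probReal_univ, one_smul] at hfst
  rw [← hfst]
  exact integral_mono (hr.comp_fst _) (hf.comp_measurable hadd)
    fun z => hmono (Nat.le_add_right _ _)

/-- The expectation of `k * f k` at a Poisson variable. -/
theorem integral_nat_mul_poissonMeasure (r : ℝ≥0) (f : ℕ → ℝ) :
    ∫ k : ℕ, (k : ℝ) * f k ∂(poissonMeasure r) = r * ∫ k, f (1 + k) ∂(poissonMeasure r) := by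
  have key : ∀ k : ℕ, Real.exp (-r) * (r : ℝ) ^ (k + 1) / (k + 1).factorial *
      (((k + 1 : ℕ) : ℝ) * f (k + 1)) =
      r * (Real.exp (-r) * (r : ℝ) ^ k / k.factorial * f (1 + k)) := by
    intro k
    rw [Nat.factorial_succ, pow_succ, add_comm 1 k]; push_cast; field_simp
  rw [integral_poissonMeasure, integral_poissonMeasure, ← tsum_mul_left]
  simp only [smul_eq_mul, ← key]
  -- The term at 0 vanishes because of the factor k, so the series runs over successors only.
  refine (Function.Injective.tsum_eq (g := Nat.succ) Nat.succ_injective ?_).symm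
  intro k hk
  cases k with
  | zero => simp at hk
  | succ k => exact ⟨k, rfl⟩

/-- The factor k cancels against k!, so the same index shift turns k f(k) into r f(1 + k). This
covers the social-cost integrand. -/
theorem integrable_nat_mul_poissonMeasure {r : ℝ≥0} {f : ℕ → ℝ}
    (hf : Integrable (fun k => f (1 + k)) (poissonMeasure r)) :
    Integrable (fun k : ℕ => (k : ℝ) * f k) (poissonMeasure r) := by
  rw [integrable_poissonMeasure_iff_summable] at hf ⊢
  rw [← summable_nat_add_iff 1]
  refine (hf.mul_left (r : ℝ)).congr fun k => ?_
  rw [Nat.factorial_succ, pow_succ, add_comm 1 k, abs_mul, Nat.abs_cast]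
  push_cast; field_simp

/-! ### Consequences of the moment condition for the auxiliary costs -/

section AuxCost

variable {E T : Type*} [Fintype T] {G : Structure E T} {d : T → ℝ}

theorem PoissonMoment.exists_integrable_cost (hP : PoissonMoment G d) :
    ∃ α : ℝ≥0, ∑ t, d t < α ∧
      ∀ e, Integrable (fun k => G.cost e (1 + k)) (poissonMeasure α) := by
  obtain ⟨ν, α, hα, h⟩ := hP
  refine ⟨α, hα, fun e => integrable_of_integrable_forward_diff
    (integrable_of_integrable_forward_diff ?_)⟩
  have h1 := (integrable_norm_iff (f := fun k => secondDiff (G.cost e) (1 + k))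
    Measurable.of_discrete.aestronglyMeasurable).1 (h e).1
  -- The forward difference of c(1 + ·), taken twice, is the second difference at 1 + k.
  convert h1 using 2 with k
  simp only [secondDiff, add_assoc]
  ring

theorem PoissonMoment.integrable_cost (hP : PoissonMoment G d) (e : E) {x : ℝ}
    (hx : x ≤ ∑ t, d t) : Integrable (fun k => G.cost e (1 + k)) (poissonMeasure x.toNNReal) := by
  obtain ⟨α, hα, h⟩ := hP.exists_integrable_cost
  exact integrable_poissonMeasure_of_le (Real.toNNReal_le_iff_le_coe.2 (hx.trans hα.le)) (h e)

/-- Negative arguments are harmless: `Real.toNNReal` sends them to rate 0. -/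
theorem PoissonMoment.monotoneOn_auxCost (hP : PoissonMoment G d) (e : E) :
    MonotoneOn (auxCost G e) (Set.Iic (∑ t, d t)) := fun _ _ _ hy hxy =>
  integral_poissonMeasure_mono (Real.toNNReal_mono hxy)
    ((G.cost_mono e).comp fun _ _ h => Nat.add_le_add_left h 1) (hP.integrable_cost e hy)

end AuxCost

/-! ## Expectations in Bernoulli games -/

namespace BernoulliGame

universe u v w

variable {E : Type u} {T : Type v}
variable {G : Structure E T} (Γ : BernoulliGame.{u, v, w} G)

theorem expect_finset_sum (σ : Γ.Profile) {κ : Type*} (K : Finset κ) (f : κ → Γ.Outcome → ℝ) :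
    Γ.expect σ (fun ω => ∑ k ∈ K, f k ω) = ∑ k ∈ K, Γ.expect σ (f k) := by
  simp only [expect, Finset.mul_sum]
  exact Finset.sum_comm

theorem expect_mul_const (σ : Γ.Profile) (f : Γ.Outcome → ℝ) (c : ℝ) :
    Γ.expect σ (fun ω => f ω * c) = Γ.expect σ f * c := by
  simp only [expect, Finset.sum_mul, mul_assoc]

/-- Finite Fubini: the law of the outcome is a product over players of laws on `Bool × Strat`. -/
theorem expect_prod (σ : Γ.Profile) (g : (i : Γ.Player) → Bool → Γ.Strat i → ℝ) :
    Γ.expect σ (fun ω => ∏ i, g i (ω.1 i) (ω.2 i)) =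
      ∏ i, ∑ s : Γ.Strat i, (σ i).1 s *
        (Γ.part i * g i true s + (1 - Γ.part i) * g i false s) := by
  have h : ∀ i, ∑ s : Γ.Strat i, (σ i).1 s *
        (Γ.part i * g i true s + (1 - Γ.part i) * g i false s) =
      ∑ x : Bool × Γ.Strat i, (if x.1 then Γ.part i else 1 - Γ.part i) * (σ i).1 x.2 *
        g i x.1 x.2 := by
    intro i
    rw [Fintype.sum_prod_type_right]
    refine Finset.sum_congr rfl fun s _ => ?_
    simp only [Fintype.sum_bool, if_true, Bool.false_eq_true, if_false]
    ring
  simp only [h, Finset.prod_univ_sum, Fintype.piFinset_univ, expect, prob]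
  refine (Fintype.sum_equiv (Equiv.arrowProdEquivProdArrow Γ.Player (fun _ => Bool) Γ.Strat)
    _ _ fun x => ?_).symm
  simp only [Equiv.arrowProdEquivProdArrow, Equiv.coe_fn_mk, Finset.prod_mul_distrib]
  rfl

variable [DecidableEq E]

/-- The probability that player `i` is active and uses the resource `e`. -/
noncomputable def useProb (σ : Γ.Profile) (e : E) (i : Γ.Player) : ℝ :=
  Γ.part i * ∑ s : Γ.Strat i, if e ∈ s.1 then (σ i).1 s else 0

/-- The number of active users of `e` within a set of players is a sum of independent Bernoulli
variables. -/
theorem expect_count (σ : Γ.Profile) (e : E) (A : Finset Γ.Player) (f : ℕ → ℝ) :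
    Γ.expect σ (fun ω => f (∑ j ∈ A, if ω.1 j ∧ e ∈ (ω.2 j).1 then 1 else 0)) =
      pbExp A (Γ.useProb σ e) f := by
  have hsum : ∀ i, ∑ s : Γ.Strat i, (σ i).1 s = 1 := fun i => (σ i).2.2
  -- Split according to the exact set B of active users within A. The indicator of this event is a
  -- product over players, so `expect_prod` applies.
  have hind : ∀ ω : Γ.Outcome, f (∑ j ∈ A, if ω.1 j ∧ e ∈ (ω.2 j).1 then 1 else 0) =
      ∑ B ∈ A.powerset, (∏ i, if i ∈ A then
        (if (ω.1 i = true ∧ e ∈ (ω.2 i).1 ↔ i ∈ B) then (1 : ℝ) else 0) else 1) * f B.card := by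
    intro ω
    rw [← Finset.card_filter, Finset.sum_eq_single (A.filter fun j => ω.1 j ∧ e ∈ (ω.2 j).1)]
    · rw [Finset.prod_eq_one, one_mul]
      intro i _
      by_cases hi : i ∈ A <;> simp [hi]
    · intro B hB hne
      obtain ⟨i, hi⟩ : ∃ i, ¬ (i ∈ B ↔ i ∈ A.filter fun j => ω.1 j ∧ e ∈ (ω.2 j).1) := by
        by_contra! h
        exact hne (Finset.ext h)
      have hiA : i ∈ A := by
        by_contra hiA
        exact hi ⟨fun h => absurd (Finset.mem_powerset.1 hB h) hiA,
          fun h => absurd (Finset.mem_filter.1 h).1 hiA⟩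
      rw [Finset.prod_eq_zero (Finset.mem_univ i), zero_mul]
      rw [if_pos hiA, if_neg]
      intro h
      exact hi (by simp [hiA, h])
    · intro h
      exact absurd (Finset.mem_powerset.2 (Finset.filter_subset _ _)) h
  simp only [hind]
  rw [expect_finset_sum, pbExp]
  refine Finset.sum_congr rfl fun B hB => ?_
  rw [expect_mul_const]
  congr 1
  rw [Γ.expect_prod σ (fun i b s => if i ∈ A then
    (if (b = true ∧ e ∈ s.1 ↔ i ∈ B) then (1 : ℝ) else 0) else 1)]
  have hB' := Finset.mem_powerset.1 hB
  -- A player contributes her use probability if she is in B, its complement if she is in A \ B, and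
  -- 1 outside A.
  have hfac : ∀ i, (∑ s : Γ.Strat i, (σ i).1 s *
      (Γ.part i * (if i ∈ A then
          (if (true = true ∧ e ∈ s.1 ↔ i ∈ B) then (1 : ℝ) else 0) else 1) +
        (1 - Γ.part i) * (if i ∈ A then
          (if (false = true ∧ e ∈ s.1 ↔ i ∈ B) then (1 : ℝ) else 0) else 1))) =
      (if i ∈ B then Γ.useProb σ e i else 1) * (if i ∈ A \ B then 1 - Γ.useProb σ e i else 1) := by
    intro i
    by_cases hiA : i ∈ A
    · by_cases hiB : i ∈ B
      · simp only [hiA, hiB, if_true, useProb, Finset.mem_sdiff, not_true, and_false, if_false,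
          mul_one, Finset.mul_sum]
        refine Finset.sum_congr rfl fun s _ => ?_
        by_cases hs : e ∈ s.1 <;> simp [hs, mul_comm]
      · simp only [hiA, hiB, if_true, useProb, Finset.mem_sdiff, not_false_eq_true, and_self,
          if_false, one_mul, Finset.mul_sum]
        conv_rhs => rw [← hsum i, ← Finset.sum_sub_distrib]
        refine Finset.sum_congr rfl fun s _ => ?_
        by_cases hs : e ∈ s.1
        · simp [hs]; ring
        · simp [hs]
    · have hiB : i ∉ B := fun h => hiA (hB' h)
      simpa [hiA, hiB] using hsum i
  rw [Finset.prod_congr rfl fun i _ => hfac i, Finset.prod_mul_distrib, Finset.prod_ite_mem,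
    Finset.prod_ite_mem, Finset.univ_inter, Finset.univ_inter]

theorem expect_cost_loadExcept (σ : Γ.Profile) (i : Γ.Player) (e : E) :
    Γ.expect σ (fun ω => G.cost e (1 + Γ.loadExcept i e ω)) =
      pbExp (Finset.univ.erase i) (Γ.useProb σ e) (fun k => G.cost e (1 + k)) :=
  Γ.expect_count σ e (Finset.univ.erase i) (fun k => G.cost e (1 + k))

theorem useProb_nonneg (σ : Γ.Profile) (e : E) (i : Γ.Player) : 0 ≤ Γ.useProb σ e i :=
  mul_nonneg (Γ.part_mem i).1.le
    (Finset.sum_nonneg fun s _ => by split_ifs; exacts [(σ i).2.1 s, le_rfl])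

theorem useProb_le_part (σ : Γ.Profile) (e : E) (i : Γ.Player) :
    Γ.useProb σ e i ≤ Γ.part i := by
  refine mul_le_of_le_one_right (Γ.part_mem i).1.le ?_
  rw [← (σ i).2.2]
  exact Finset.sum_le_sum fun s _ => by split_ifs; exacts [le_rfl, (σ i).2.1 s]

theorem useProb_update_of_ne (σ : Γ.Profile) {i j : Γ.Player} (h : j ≠ i)
    (τ : stdSimplex ℝ (Γ.Strat i)) (e : E) :
    Γ.useProb (Function.update σ i τ) e j = Γ.useProb σ e j := by
  simp only [useProb, Function.update_of_ne h]

theorem pbExp_erase_update (σ : Γ.Profile) (i : Γ.Player) (τ : stdSimplex ℝ (Γ.Strat i)) (e : E)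
    (f : ℕ → ℝ) : pbExp (Finset.univ.erase i) (Γ.useProb (Function.update σ i τ) e) f =
      pbExp (Finset.univ.erase i) (Γ.useProb σ e) f :=
  pbExp_congr_prob _ (fun _ hj => Γ.useProb_update_of_ne σ (Finset.ne_of_mem_erase hj) τ e) f

theorem continuous_pbExp_useProb (e : E) (A : Finset Γ.Player) (f : ℕ → ℝ) :
    Continuous fun σ : Γ.Profile => pbExp A (Γ.useProb σ e) f := by
  have hs : ∀ i (s : Γ.Strat i), Continuous fun σ : Γ.Profile => (σ i).1 s := fun i s =>
    (continuous_apply s).comp (continuous_subtype_val.comp (continuous_apply i))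
  have hu : ∀ i, Continuous fun σ : Γ.Profile => Γ.useProb σ e i := fun i =>
    continuous_const.mul (continuous_finsetSum _ fun s _ => by
      split_ifs
      exacts [hs i s, continuous_const])
  exact continuous_finsetSum _ fun B _ => ((continuous_finsetProd _ fun i _ => hu i).mul
    (continuous_finsetProd _ fun i _ => continuous_const.sub (hu i))).mul continuous_const

theorem isClosed_bne : IsClosed Γ.bne := by
  have hs : ∀ i (s : Γ.Strat i), Continuous fun σ : Γ.Profile => (σ i).1 s := fun i s =>
    (continuous_apply s).comp (continuous_subtype_val.comp (continuous_apply i))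
  have hK : ∀ i (s : Γ.Strat i), Continuous fun σ : Γ.Profile =>
      ∑ e ∈ s.1, Γ.expect σ (fun ω => G.cost e (1 + Γ.loadExcept i e ω)) := fun i s => by
    simp only [expect_cost_loadExcept]
    exact continuous_finsetSum _ fun e _ => Γ.continuous_pbExp_useProb e _ _
  simp only [bne, Set.ofPred_forall]
  refine isClosed_iInter fun i => isClosed_iInter fun s => isClosed_iInter fun s' => ?_
  -- The implication becomes a union of two closed conditions: the strategy has weight at most 0, or
  -- the cost inequality holds.
  simp only [imp_iff_not_or, not_lt, Set.ofPred_or]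
  exact (isClosed_le (hs i s) continuous_const).union (isClosed_le (hK i s) (hK i s'))

/-- The expected cost of the strategy `s` to player `i` when she takes part. -/
noncomputable def stratCost (σ : Γ.Profile) (i : Γ.Player) (s : Γ.Strat i) : ℝ :=
  ∑ e ∈ s.1, pbExp (Finset.univ.erase i) (Γ.useProb σ e) (fun k => G.cost e (1 + k))

theorem mem_bne_iff {σ : Γ.Profile} : σ ∈ Γ.bne ↔
    ∀ i, ∀ s s' : Γ.Strat i, 0 < (σ i).1 s → Γ.stratCost σ i s ≤ Γ.stratCost σ i s' := by
  simp only [bne, Set.mem_ofPred_eq, expect_cost_loadExcept, stratCost]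

variable [Fintype E]

theorem esc_eq (σ : Γ.Profile) :
    Γ.esc σ = ∑ e, pbExp Finset.univ (Γ.useProb σ e) (fun k => k * G.cost e k) := by
  rw [esc, expect_finset_sum]
  exact Finset.sum_congr rfl fun e _ => Γ.expect_count σ e Finset.univ (fun k => k * G.cost e k)

/-! ## Existence of equilibria -/

theorem continuous_esc : Continuous Γ.esc := by
  simp only [funext fun σ => Γ.esc_eq σ]
  exact continuous_finsetSum _ fun e _ => Γ.continuous_pbExp_useProb e _ _

instance instNonemptyStrat (i : Γ.Player) : Nonempty (Γ.Strat i) :=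
  (G.strat_nonempty (Γ.typ i)).to_subtype

/-- The expected Rosenthal potential. -/
noncomputable def potential (σ : Γ.Profile) : ℝ :=
  ∑ e, pbExp Finset.univ (Γ.useProb σ e) (fun k => ∑ l ∈ Finset.range k, G.cost e (1 + l))

/-- When player i joins e, the potential grows by c_e(1 + Z). Hence it is affine in her mixed
strategy, with coefficients r_i times her expected strategy costs, and the first sum depends only on
the others. -/
theorem potential_eq (σ : Γ.Profile) (i : Γ.Player) :
    Γ.potential σ = (∑ e, pbExp (Finset.univ.erase i) (Γ.useProb σ e)
        (fun k => ∑ l ∈ Finset.range k, G.cost e (1 + l))) +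
      Γ.part i * ∑ s : Γ.Strat i, (σ i).1 s * Γ.stratCost σ i s := by
  have h : ∀ e, pbExp Finset.univ (Γ.useProb σ e)
        (fun k => ∑ l ∈ Finset.range k, G.cost e (1 + l)) =
      pbExp (Finset.univ.erase i) (Γ.useProb σ e)
        (fun k => ∑ l ∈ Finset.range k, G.cost e (1 + l)) +
      Γ.useProb σ e i * pbExp (Finset.univ.erase i) (Γ.useProb σ e)
        (fun k => G.cost e (1 + k)) := by
    intro e
    rw [pbExp_erase (Finset.mem_univ i)]
    have hd := pbExp_sub (Finset.univ.erase i) (Γ.useProb σ e)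
      (fun k => ∑ l ∈ Finset.range (k + 1), G.cost e (1 + l))
      (fun k => ∑ l ∈ Finset.range k, G.cost e (1 + l))
    simp only [Finset.sum_range_succ_sub_sum] at hd
    rw [hd]
    ring
  simp only [potential, h, Finset.sum_add_distrib, add_right_inj, useProb, mul_assoc,
    ← Finset.mul_sum]
  congr 1
  simp only [stratCost, Finset.sum_mul, Finset.mul_sum]
  rw [Finset.sum_comm]
  refine Finset.sum_congr rfl fun s _ => ?_
  simp only [ite_mul, zero_mul, Finset.sum_ite_mem, Finset.univ_inter]

theorem bne_nonempty : Γ.bne.Nonempty := by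
  have hcont : Continuous Γ.potential :=
    continuous_finsetSum _ fun e _ => Γ.continuous_pbExp_useProb e _ _
  obtain ⟨σ, -, hσ⟩ := (isCompact_univ (X := Γ.Profile)).exists_isMinOn Set.univ_nonempty
    hcont.continuousOn
  refine ⟨σ, Γ.mem_bne_iff.2 fun i s s' hs => ?_⟩
  -- At a minimiser of the potential, deviating to a pure strategy cannot lower it; since r_i > 0
  -- can be cancelled, the average cost of player i is at most the cost of each pure strategy.
  have hmin : ∀ s', ∑ s : Γ.Strat i, (σ i).1 s * Γ.stratCost σ i s ≤ Γ.stratCost σ i s' := by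
    intro s'
    have h := hσ (Set.mem_univ (Function.update σ i ⟨Pi.single s' 1, single_mem_stdSimplex ℝ s'⟩))
    simp only [Set.mem_ofPred_eq] at h
    rw [Γ.potential_eq σ i, Γ.potential_eq _ i] at h
    simp only [stratCost, pbExp_erase_update, add_le_add_iff_left, Function.update_self] at h
    have h2 := le_of_mul_le_mul_left h (Γ.part_mem i).1
    simpa [stratCost, Pi.single_apply] using h2
  set m := ∑ s : Γ.Strat i, (σ i).1 s * Γ.stratCost σ i s with hm
  -- The average of nonnegative excess costs is zero, so every strategy in the support has cost
  -- exactly m.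
  have h0 : ∑ s : Γ.Strat i, (σ i).1 s * (Γ.stratCost σ i s - m) = 0 := by
    simp only [mul_sub, Finset.sum_sub_distrib, ← Finset.sum_mul, (σ i).2.2, one_mul, ← hm,
      sub_self]
  have h1 := (Finset.sum_eq_zero_iff_of_nonneg fun s _ =>
    mul_nonneg ((σ i).2.1 s) (sub_nonneg.2 (hmin s))).1 h0 s (Finset.mem_univ s)
  have h2 : Γ.stratCost σ i s - m = 0 := (mul_eq_zero.1 h1).resolve_left hs.ne'
  linarith [hmin s']

/-! ### Attainment of the optimum and of the extremal equilibrium ratios -/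

theorem isLeast_opt : IsLeast (Set.range Γ.esc) Γ.opt := by
  rw [opt, ← Set.image_univ]
  exact (isCompact_univ.image Γ.continuous_esc).isLeast_sInf (Set.univ_nonempty.image _)

theorem isCompact_image_bne : IsCompact ((fun σ => Γ.esc σ / Γ.opt) '' Γ.bne) :=
  Γ.isClosed_bne.isCompact.image (Γ.continuous_esc.div_const _)

theorem isGreatest_poa : IsGreatest ((fun σ => Γ.esc σ / Γ.opt) '' Γ.bne) Γ.poa :=
  Γ.isCompact_image_bne.isGreatest_sSup (Γ.bne_nonempty.image _)

theorem isLeast_pos : IsLeast ((fun σ => Γ.esc σ / Γ.opt) '' Γ.bne) Γ.pos :=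
  Γ.isCompact_image_bne.isLeast_sInf (Γ.bne_nonempty.image _)

end BernoulliGame

/-! ## Expected flows in Bernoulli games -/

namespace BernoulliGame

variable {E : Type u} {T : Type v} {G : Structure E T} (Γ : BernoulliGame.{u, v, w} G)

theorem part_le_maxPart (i : Γ.Player) : Γ.part i ≤ Γ.maxPart :=
  le_ciSup (Set.finite_range _).bddAbove i

variable [DecidableEq E]

/-- The probability that player `i` chooses `s`, for an arbitrary set `s` of resources. -/
noncomputable def choiceProb (σ : Γ.Profile) (i : Γ.Player) (s : Finset E) : ℝ :=
  if h : s ∈ G.strat (Γ.typ i) then (σ i).1 ⟨s, h⟩ else 0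

theorem choiceProb_coe (σ : Γ.Profile) (i : Γ.Player) (s : Γ.Strat i) :
    Γ.choiceProb σ i s.1 = (σ i).1 s := dif_pos s.2

theorem choiceProb_nonneg (σ : Γ.Profile) (i : Γ.Player) (s : Finset E) :
    0 ≤ Γ.choiceProb σ i s := by
  unfold choiceProb
  split_ifs
  exacts [(σ i).2.1 _, le_rfl]

theorem sum_choiceProb (σ : Γ.Profile) {i : Γ.Player} {t : T} (h : Γ.typ i = t) :
    ∑ s : G.strat t, Γ.choiceProb σ i s.1 = 1 := by
  subst h
  simp only [choiceProb_coe]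
  exact (σ i).2.2

theorem useProb_eq (σ : Γ.Profile) (e : E) {i : Γ.Player} {t : T} (h : Γ.typ i = t) :
    Γ.useProb σ e i =
      ∑ s : G.strat t, if e ∈ s.1 then Γ.part i * Γ.choiceProb σ i s.1 else 0 := by
  subst h
  simp only [choiceProb_coe, useProb, Finset.mul_sum, mul_ite, mul_zero]

theorem sum_pbExp_le_of_mem_bne {σ : Γ.Profile} (hσ : σ ∈ Γ.bne) {i : Γ.Player} {t : T}
    (h : Γ.typ i = t) (s s' : G.strat t) (hs : 0 < Γ.choiceProb σ i s.1) :
    ∑ e ∈ s.1, pbExp (Finset.univ.erase i) (Γ.useProb σ e) (fun k => G.cost e (1 + k)) ≤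
      ∑ e ∈ s'.1, pbExp (Finset.univ.erase i) (Γ.useProb σ e) (fun k => G.cost e (1 + k)) := by
  subst h
  rw [choiceProb_coe] at hs
  exact Γ.mem_bne_iff.1 hσ i s s' hs

variable [DecidableEq T]

/-- The expected number of active players of type `t` that choose `s`. -/
noncomputable def flow (σ : Γ.Profile) (t : T) (s : G.strat t) : ℝ :=
  ∑ i with Γ.typ i = t, Γ.part i * Γ.choiceProb σ i s.1

theorem flow_nonneg (σ : Γ.Profile) (t : T) (s : G.strat t) : 0 ≤ Γ.flow σ t s :=
  Finset.sum_nonneg fun i _ => mul_nonneg (Γ.part_mem i).1.le (Γ.choiceProb_nonneg σ i s.1)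

theorem sum_flow (σ : Γ.Profile) (t : T) : ∑ s : G.strat t, Γ.flow σ t s = Γ.demand t := by
  unfold flow demand
  rw [Finset.sum_comm]
  refine Finset.sum_congr rfl fun i hi => ?_
  rw [← Finset.mul_sum, Γ.sum_choiceProb σ (Finset.mem_filter.1 hi).2, mul_one]

theorem flow_le_demand (σ : Γ.Profile) (t : T) (s : G.strat t) : Γ.flow σ t s ≤ Γ.demand t := by
  rw [← Γ.sum_flow σ t]
  exact Finset.single_le_sum (fun s _ => Γ.flow_nonneg σ t s) (Finset.mem_univ s)

/-- Expected loads depend on the profile only through its flow, and linearly, so convergence of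
flows carries over to loads. -/
theorem sum_useProb [Fintype T] (σ : Γ.Profile) (e : E) :
    ∑ i, Γ.useProb σ e i =
      ∑ t, ∑ s : G.strat t, if e ∈ s.1 then Γ.flow σ t s else 0 := by
  rw [← Finset.sum_fiberwise Finset.univ Γ.typ]
  refine Finset.sum_congr rfl fun t _ => ?_
  rw [Finset.sum_congr rfl fun i hi => Γ.useProb_eq σ e (Finset.mem_filter.1 hi).2,
    Finset.sum_comm]
  refine Finset.sum_congr rfl fun s _ => ?_
  split_ifs
  · rfl
  · simp

theorem exists_player_of_flow_pos (σ : Γ.Profile) {t : T} {s : G.strat t}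
    (h : 0 < Γ.flow σ t s) : ∃ i, Γ.typ i = t ∧ 0 < Γ.choiceProb σ i s.1 := by
  by_contra! hc
  refine h.not_ge (Finset.sum_nonpos fun i hi => ?_)
  exact mul_nonpos_of_nonneg_of_nonpos (Γ.part_mem i).1.le (hc i (Finset.mem_filter.1 hi).2)

end BernoulliGame

/-! ## Uniqueness of the equilibrium cost of nonatomic games -/

namespace NonatomicGame

variable {E : Type u} {T : Type v} [DecidableEq E] [Fintype T] {Γ : NonatomicGame E T}

theorem load_le_of_mem_feasible {p : Γ.FlowLoad}
    (hp : p ∈ Γ.feasible) (e : E) : p.2 e ≤ ∑ t, Γ.demand t := by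
  rw [hp.2.2 e]
  refine Finset.sum_le_sum fun t _ => ?_
  rw [hp.2.1 t]
  exact Finset.sum_le_sum fun s _ => by split_ifs; exacts [le_rfl, hp.1 t s]

theorem load_nonneg_of_mem_feasible {p : Γ.FlowLoad}
    (hp : p ∈ Γ.feasible) (e : E) : 0 ≤ p.2 e := by
  rw [hp.2.2 e]
  exact Finset.sum_nonneg fun t _ => Finset.sum_nonneg fun s _ => by
    split_ifs; exacts [hp.1 t s, le_rfl]

variable [Fintype E]

theorem sum_load_mul {p : Γ.FlowLoad} (hp : p ∈ Γ.feasible) (c : E → ℝ) :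
    ∑ e, p.2 e * c e = ∑ t, ∑ s : Γ.strat t, p.1 t s * ∑ e ∈ s.1, c e := by
  simp only [hp.2.2, Finset.sum_mul]
  rw [Finset.sum_comm]
  refine Finset.sum_congr rfl fun t _ => ?_
  rw [Finset.sum_comm]
  refine Finset.sum_congr rfl fun s _ => ?_
  simp only [ite_mul, zero_mul, Finset.sum_ite_mem, Finset.univ_inter, Finset.mul_sum]

/-- The variational inequality for Wardrop equilibria. -/
theorem socialCost_le_of_mem_wardrop (hne : ∀ t, (Γ.strat t).Nonempty) {p q : Γ.FlowLoad}
    (hp : p ∈ Γ.wardrop) (hq : q ∈ Γ.feasible) :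
    Γ.socialCost p ≤ ∑ e, q.2 e * Γ.cost e (p.2 e) := by
  rw [socialCost, sum_load_mul hp.1, sum_load_mul hq]
  refine Finset.sum_le_sum fun t _ => ?_
  have : Nonempty (Γ.strat t) := (hne t).to_subtype
  obtain ⟨s₀, hs₀⟩ := Finite.exists_min fun s : Γ.strat t => ∑ e ∈ s.1, Γ.cost e (p.2 e)
  -- At the loads of p, the flow p uses only strategies no dearer than the cheapest one s₀, while q
  -- routes the same demand at no less than that price.
  calc ∑ s : Γ.strat t, p.1 t s * ∑ e ∈ s.1, Γ.cost e (p.2 e)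
      ≤ ∑ s : Γ.strat t, p.1 t s * ∑ e ∈ s₀.1, Γ.cost e (p.2 e) := by
        refine Finset.sum_le_sum fun s _ => ?_
        rcases (hp.1.1 t s).eq_or_lt with h | h
        · simp [← h]
        · exact mul_le_mul_of_nonneg_left (hp.2 t s s₀ h) h.le
    _ = ∑ s : Γ.strat t, q.1 t s * ∑ e ∈ s₀.1, Γ.cost e (p.2 e) := by
        rw [← Finset.sum_mul, ← Finset.sum_mul, ← hp.1.2.1 t, ← hq.2.1 t]
    _ ≤ ∑ s : Γ.strat t, q.1 t s * ∑ e ∈ s.1, Γ.cost e (p.2 e) :=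
        Finset.sum_le_sum fun s _ => mul_le_mul_of_nonneg_left (hs₀ s) (hq.1 t s)

/-- Adding the two variational inequalities gives ∑ (x - x')(c(x) - c(x')) ≤ 0, whose terms are
nonnegative by monotonicity and hence all zero. So resource costs agree even where loads differ, and
the two inequalities then compare the social costs both ways. -/
theorem socialCost_eq_of_mem_wardrop (hne : ∀ t, (Γ.strat t).Nonempty)
    (hmono : ∀ e, MonotoneOn (Γ.cost e) (Set.Iic (∑ t, Γ.demand t))) {p q : Γ.FlowLoad}
    (hp : p ∈ Γ.wardrop) (hq : q ∈ Γ.wardrop) : Γ.socialCost p = Γ.socialCost q := by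
  have h1 := socialCost_le_of_mem_wardrop hne hp hq.1
  have h2 := socialCost_le_of_mem_wardrop hne hq hp.1
  have hterm : ∀ e, 0 ≤ (p.2 e - q.2 e) * (Γ.cost e (p.2 e) - Γ.cost e (q.2 e)) := by
    intro e
    have hpe := load_le_of_mem_feasible hp.1 e
    have hqe := load_le_of_mem_feasible hq.1 e
    rcases le_total (p.2 e) (q.2 e) with h | h
    · exact mul_nonneg_of_nonpos_of_nonpos (sub_nonpos.2 h) (sub_nonpos.2 (hmono e hpe hqe h))
    · exact mul_nonneg (sub_nonneg.2 h) (sub_nonneg.2 (hmono e hqe hpe h))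
  have hsum : ∑ e, (p.2 e - q.2 e) * (Γ.cost e (p.2 e) - Γ.cost e (q.2 e)) = 0 := by
    refine le_antisymm ?_ (Finset.sum_nonneg fun e _ => hterm e)
    have : ∑ e, (p.2 e - q.2 e) * (Γ.cost e (p.2 e) - Γ.cost e (q.2 e)) =
        Γ.socialCost p - ∑ e, q.2 e * Γ.cost e (p.2 e) +
          (Γ.socialCost q - ∑ e, p.2 e * Γ.cost e (q.2 e)) := by
      simp only [socialCost, ← Finset.sum_sub_distrib, ← Finset.sum_add_distrib]
      exact Finset.sum_congr rfl fun e _ => by ring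
    linarith
  have hcost : ∀ e, Γ.cost e (p.2 e) = Γ.cost e (q.2 e) := by
    intro e
    rcases mul_eq_zero.1 ((Finset.sum_eq_zero_iff_of_nonneg fun e _ => hterm e).1 hsum e
      (Finset.mem_univ e)) with h | h
    · rw [sub_eq_zero.1 h]
    · exact sub_eq_zero.1 h
  refine le_antisymm ?_ ?_
  · simpa only [socialCost, hcost] using h1
  · simpa only [socialCost, hcost] using h2

end NonatomicGame

/-! ## Passage to the limit -/

section Limit

variable {E : Type u} {T : Type v} [DecidableEq T]
  {G : Structure E T} {Γ : ℕ → BernoulliGame.{u, v, w} G} {d : T → ℝ}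

theorem AsymptoticallyPoisson.comp (hΓ : AsymptoticallyPoisson Γ d) {φ : ℕ → ℕ}
    (hφ : Tendsto φ atTop atTop) : AsymptoticallyPoisson (fun n => Γ (φ n)) d where
  card_tendsto := hΓ.card_tendsto.comp hφ
  maxPart_tendsto := hΓ.maxPart_tendsto.comp hφ
  demand_tendsto t := (hΓ.demand_tendsto t).comp hφ

variable [DecidableEq E]

/-- The player sets A are left free: all players for the social cost, all but one for the
equilibrium condition. -/
theorem tendsto_pbExp_useProb (hΓ : AsymptoticallyPoisson Γ d) {σ : ∀ n, (Γ n).Profile}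
    {e : E} {x : ℝ} {α : ℝ≥0} (hx : x < α) {f : ℕ → ℝ} (hf : Integrable f (poissonMeasure α))
    {A : ∀ n, Finset (Γ n).Player}
    (hA : Tendsto (fun n => ∑ i ∈ A n, (Γ n).useProb (σ n) e i) atTop (𝓝 x)) :
    Tendsto (fun n => pbExp (A n) ((Γ n).useProb (σ n) e) f) atTop
      (𝓝 (∫ k, f k ∂(poissonMeasure x.toNNReal))) :=
  tendsto_pbExp (fun n i => (Γ n).useProb_nonneg _ e i)
    (fun n i => ((Γ n).useProb_le_part _ e i).trans ((Γ n).part_mem i).2.le)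
    (fun n i _ => ((Γ n).useProb_le_part _ e i).trans ((Γ n).part_le_maxPart i))
    hΓ.maxPart_tendsto hA hx hf

variable [Fintype T]

/-- The pair of a strategy flow and the loads it induces. -/
def flowLoad (G : Structure E T) (d : T → ℝ) (y : (t : T) → G.strat t → ℝ) :
    (limitGame G d).FlowLoad :=
  (y, fun e => ∑ t, ∑ s : G.strat t, if e ∈ s.1 then y t s else 0)

theorem flowLoad_mem_feasible (hΓ : AsymptoticallyPoisson Γ d) {σ : ∀ n, (Γ n).Profile}
    {y : (t : T) → G.strat t → ℝ} (hy : Tendsto (fun n => (Γ n).flow (σ n)) atTop (𝓝 y)) :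
    flowLoad G d y ∈ (limitGame G d).feasible := by
  have hy' : ∀ t s, Tendsto (fun n => (Γ n).flow (σ n) t s) atTop (𝓝 (y t s)) := fun t s =>
    tendsto_pi_nhds.1 (tendsto_pi_nhds.1 hy t) s
  refine ⟨fun t s => ge_of_tendsto' (hy' t s) fun n => (Γ n).flow_nonneg _ t s, fun t => ?_,
    fun e => rfl⟩
  refine tendsto_nhds_unique (hΓ.demand_tendsto t) ?_
  simp only [← fun n => (Γ n).sum_flow (σ n) t]
  exact tendsto_finsetSum _ fun s _ => hy' t s

theorem tendsto_sum_useProb {σ : ∀ n, (Γ n).Profile}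
    {y : (t : T) → G.strat t → ℝ} (hy : Tendsto (fun n => (Γ n).flow (σ n)) atTop (𝓝 y)) (e : E) :
    Tendsto (fun n => ∑ i, (Γ n).useProb (σ n) e i) atTop (𝓝 ((flowLoad G d y).2 e)) := by
  simp only [BernoulliGame.sum_useProb]
  refine tendsto_finsetSum _ fun t _ => tendsto_finsetSum _ fun s _ => ?_
  split_ifs
  · exact tendsto_pi_nhds.1 (tendsto_pi_nhds.1 hy t) s
  · exact tendsto_const_nhds

/-- The Poisson identity 𝔼[X c(X)] = x 𝔼[c(1 + X)] turns the limit of the expected cost on e into x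
times the auxiliary cost. -/
theorem tendsto_esc [Fintype E] (hΓ : AsymptoticallyPoisson Γ d) (hP : PoissonMoment G d)
    {σ : ∀ n, (Γ n).Profile} {y : (t : T) → G.strat t → ℝ}
    (hy : Tendsto (fun n => (Γ n).flow (σ n)) atTop (𝓝 y)) :
    Tendsto (fun n => (Γ n).esc (σ n)) atTop
      (𝓝 ((limitGame G d).socialCost (flowLoad G d y))) := by
  obtain ⟨α, hα, hint⟩ := hP.exists_integrable_cost
  have hfeas := flowLoad_mem_feasible hΓ hy
  simp only [BernoulliGame.esc_eq]
  refine tendsto_finsetSum _ fun e _ => ?_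
  have h := tendsto_pbExp_useProb hΓ ((NonatomicGame.load_le_of_mem_feasible hfeas e).trans_lt hα)
    (integrable_nat_mul_poissonMeasure (hint e)) (tendsto_sum_useProb (d := d) hy e)
  rwa [integral_nat_mul_poissonMeasure,
    Real.coe_toNNReal _ (NonatomicGame.load_nonneg_of_mem_feasible hfeas e)] at h

theorem flowLoad_mem_wardrop (hΓ : AsymptoticallyPoisson Γ d) (hP : PoissonMoment G d)
    {σ : ∀ n, (Γ n).Profile} (hσ : ∀ n, σ n ∈ (Γ n).bne) {y : (t : T) → G.strat t → ℝ}
    (hy : Tendsto (fun n => (Γ n).flow (σ n)) atTop (𝓝 y)) :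
    flowLoad G d y ∈ (limitGame G d).wardrop := by
  obtain ⟨α, hα, hint⟩ := hP.exists_integrable_cost
  have hfeas := flowLoad_mem_feasible hΓ hy
  refine ⟨hfeas, fun t s s' hs => ?_⟩
  have hpos : ∀ᶠ n in atTop, 0 < (Γ n).flow (σ n) t s :=
    (tendsto_pi_nhds.1 (tendsto_pi_nhds.1 hy t) s).eventually_const_lt hs
  -- A omits one player of type t who uses s with positive probability, so her equilibrium
  -- inequality is available and loads change by at most the largest participation probability. When
  -- the flow on s is zero, which eventually does not happen, A is a dummy value.
  have hA : ∀ n, ∃ A : Finset (Γ n).Player,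
      (∀ e, |∑ i ∈ A, (Γ n).useProb (σ n) e i - ∑ i, (Γ n).useProb (σ n) e i| ≤
        |(Γ n).maxPart|) ∧
      (0 < (Γ n).flow (σ n) t s →
        ∑ e ∈ s.1, pbExp A ((Γ n).useProb (σ n) e) (fun k => G.cost e (1 + k)) ≤
          ∑ e ∈ s'.1, pbExp A ((Γ n).useProb (σ n) e) (fun k => G.cost e (1 + k))) := by
    intro n
    by_cases hn : 0 < (Γ n).flow (σ n) t s
    · obtain ⟨i, hi, his⟩ := (Γ n).exists_player_of_flow_pos _ hn
      refine ⟨Finset.univ.erase i, fun e => ?_, fun _ =>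
        (Γ n).sum_pbExp_le_of_mem_bne (hσ n) hi s s' his⟩
      rw [← Finset.add_sum_erase _ _ (Finset.mem_univ i), sub_add_cancel_right, abs_neg,
        abs_of_nonneg ((Γ n).useProb_nonneg _ e i)]
      exact (((Γ n).useProb_le_part _ e i).trans ((Γ n).part_le_maxPart i)).trans (le_abs_self _)
    · exact ⟨Finset.univ, fun e => by simp, fun h => absurd h hn⟩
  choose A hA1 hA2 using hA
  have hsum : ∀ e, Tendsto (fun n => ∑ i ∈ A n, (Γ n).useProb (σ n) e i) atTop
      (𝓝 ((flowLoad G d y).2 e)) := by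
    intro e
    have h0 : Tendsto (fun n => ∑ i ∈ A n, (Γ n).useProb (σ n) e i -
        ∑ i, (Γ n).useProb (σ n) e i) atTop (𝓝 0) :=
      squeeze_zero_norm (fun n => hA1 n e) (by simpa using hΓ.maxPart_tendsto.abs)
    simpa using h0.add (tendsto_sum_useProb (d := d) hy e)
  have hlim : ∀ s : G.strat t, Tendsto (fun n => ∑ e ∈ s.1,
      pbExp (A n) ((Γ n).useProb (σ n) e) (fun k => G.cost e (1 + k))) atTop
      (𝓝 (∑ e ∈ s.1, auxCost G e ((flowLoad G d y).2 e))) := fun s =>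
    tendsto_finsetSum _ fun e _ => tendsto_pbExp_useProb hΓ
      ((NonatomicGame.load_le_of_mem_feasible hfeas e).trans_lt hα) (hint e) (hsum e)
  exact le_of_tendsto_of_tendsto (hlim s) (hlim s') (hpos.mono fun n hn => hA2 n hn)

/-- Every sequence of profiles has a subsequence along which the expected flows converge. -/
theorem exists_subseq_tendsto_flow (hΓ : AsymptoticallyPoisson Γ d) (σ : ∀ n, (Γ n).Profile) :
    ∃ (y : (t : T) → G.strat t → ℝ) (φ : ℕ → ℕ), StrictMono φ ∧
      Tendsto (fun n => (Γ (φ n)).flow (σ (φ n))) atTop (𝓝 y) := by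
  have hb : ∀ t, ∃ C, ∀ n, (Γ n).demand t ≤ C := fun t => by
    obtain ⟨C, hC⟩ := (hΓ.demand_tendsto t).bddAbove_range
    exact ⟨C, fun n => hC ⟨n, rfl⟩⟩
  choose C hC using hb
  have hmem : ∀ n, (Γ n).flow (σ n) ∈
      Set.Icc (0 : (t : T) → G.strat t → ℝ) (fun t _ => C t) := fun n =>
    ⟨fun t s => (Γ n).flow_nonneg _ t s, fun t s => ((Γ n).flow_le_demand _ t s).trans (hC t n)⟩
  obtain ⟨y, -, φ, hφ, hy⟩ := isCompact_Icc.tendsto_subseq hmem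
  exact ⟨y, φ, hφ, hy⟩

/-- Every feasible flow of the limit game is a limit of expected flows. -/
theorem exists_tendsto_flow (hΓ : AsymptoticallyPoisson Γ d) {p : (limitGame G d).FlowLoad}
    (hp : p ∈ (limitGame G d).feasible) :
    ∃ σ : ∀ n, (Γ n).Profile, Tendsto (fun n => (Γ n).flow (σ n)) atTop (𝓝 p.1) := by
  have hd : ∀ t, d t = ∑ s : G.strat t, p.1 t s := hp.2.1
  -- τ consists of the shares of the demand d_t; if d_t = 0, then all flows vanish and any strategy
  -- will do.
  have hτ : ∀ t, ∃ τ : stdSimplex ℝ (G.strat t), ∀ s, d t * τ.1 s = p.1 t s := by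
    intro t
    by_cases h : d t = 0
    · obtain ⟨s₀, hs₀⟩ := G.strat_nonempty t
      refine ⟨⟨Pi.single ⟨s₀, hs₀⟩ 1, single_mem_stdSimplex ℝ _⟩, fun s => ?_⟩
      have h0 := (Finset.sum_eq_zero_iff_of_nonneg fun s _ => hp.1 t s).1 ((hd t).symm.trans h)
      rw [h, zero_mul, h0 s (Finset.mem_univ _)]
    · refine ⟨⟨fun s => p.1 t s / d t, fun s => div_nonneg (hp.1 t s) ?_, ?_⟩, fun s =>
        mul_div_cancel₀ _ h⟩
      · rw [hd t]
        exact Finset.sum_nonneg fun s _ => hp.1 t s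
      · exact (Finset.sum_div Finset.univ (fun s : G.strat t => p.1 t s) (d t)).symm.trans
          ((congrArg (· / d t) (hd t).symm).trans (div_self h))
  choose τ hτ using hτ
  -- All players of a type play the same mixed strategy, so the flow is the demand times the share.
  refine ⟨fun n i => τ ((Γ n).typ i), tendsto_pi_nhds.2 fun t => tendsto_pi_nhds.2 fun s => ?_⟩
  have hflow : ∀ n, (Γ n).flow (fun i => τ ((Γ n).typ i)) t s = (Γ n).demand t * (τ t).1 s := by
    intro n
    rw [BernoulliGame.flow, BernoulliGame.demand, Finset.sum_mul]
    refine Finset.sum_congr rfl fun i hi => ?_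
    obtain rfl := (Finset.mem_filter.1 hi).2
    rw [BernoulliGame.choiceProb_coe]
  simp only [hflow, ← hτ t s]
  exact (hΓ.demand_tendsto t).mul_const _

end Limit

/-! ## Convergence of equilibrium costs and of optimal costs -/

section Convergence

variable {E : Type u} {T : Type v} [Fintype E] [DecidableEq E] [Fintype T] [DecidableEq T]
  {G : Structure E T} {Γ : ℕ → BernoulliGame.{u, v, w} G} {d : T → ℝ}

omit [Fintype E] [DecidableEq T] in
theorem flowLoad_fst {p : (limitGame G d).FlowLoad} (hp : p ∈ (limitGame G d).feasible) :
    flowLoad G d p.1 = p := Prod.ext rfl (funext fun e => (hp.2.2 e).symm)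

/-- The limit of optimal flows is optimal: any feasible competitor is a limit of flows of profiles
whose expected costs are at least the finite optima. This yields existence of the limit optimum as
well. -/
theorem exists_subseq_tendsto_opt (hΓ : AsymptoticallyPoisson Γ d) (hP : PoissonMoment G d) :
    ∃ (c : ℝ) (φ : ℕ → ℕ),
      IsLeast ((limitGame G d).socialCost '' (limitGame G d).feasible) c ∧
      Tendsto φ atTop atTop ∧ Tendsto (fun n => (Γ (φ n)).opt) atTop (𝓝 c) := by
  choose σ hσ using fun n => (Γ n).isLeast_opt.1
  obtain ⟨y, φ, hφ, hy⟩ := exists_subseq_tendsto_flow hΓ σ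
  have hΓφ := hΓ.comp hφ.tendsto_atTop
  have hesc := tendsto_esc hΓφ hP hy
  simp only [hσ] at hesc
  refine ⟨_, φ, ⟨⟨_, flowLoad_mem_feasible hΓφ hy, rfl⟩, ?_⟩, hφ.tendsto_atTop, hesc⟩
  rintro _ ⟨p, hp, rfl⟩
  obtain ⟨τ, hτ⟩ := exists_tendsto_flow hΓφ hp
  have h := tendsto_esc hΓφ hP hτ
  rw [flowLoad_fst hp] at h
  exact le_of_tendsto_of_tendsto' hesc h fun n => (Γ (φ n)).isLeast_opt.2 ⟨_, rfl⟩

theorem isLeast_limitGame_opt (hΓ : AsymptoticallyPoisson Γ d) (hP : PoissonMoment G d) :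
    IsLeast ((limitGame G d).socialCost '' (limitGame G d).feasible) (limitGame G d).opt := by
  obtain ⟨c, -, hc, -⟩ := exists_subseq_tendsto_opt hΓ hP
  rwa [NonatomicGame.opt, hc.csInf_eq]

theorem tendsto_opt (hΓ : AsymptoticallyPoisson Γ d) (hP : PoissonMoment G d) :
    Tendsto (fun n => (Γ n).opt) atTop (𝓝 (limitGame G d).opt) := by
  -- Every subsequence has a further one converging to a least social cost, and a least element is
  -- unique.
  refine tendsto_of_subseq_tendsto fun ns hns => ?_
  obtain ⟨c, φ, hc, -, hlim⟩ := exists_subseq_tendsto_opt (hΓ.comp hns) hP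
  exact ⟨φ, by rwa [NonatomicGame.opt, hc.csInf_eq]⟩

theorem exists_subseq_tendsto_esc (hΓ : AsymptoticallyPoisson Γ d) (hP : PoissonMoment G d)
    {σ : ∀ n, (Γ n).Profile} (hσ : ∀ n, σ n ∈ (Γ n).bne) :
    ∃ p ∈ (limitGame G d).wardrop, ∃ φ : ℕ → ℕ,
      Tendsto (fun n => (Γ (φ n)).esc (σ (φ n))) atTop (𝓝 ((limitGame G d).socialCost p)) := by
  obtain ⟨y, φ, hφ, hy⟩ := exists_subseq_tendsto_flow hΓ σ
  have hΓφ := hΓ.comp hφ.tendsto_atTop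
  exact ⟨_, flowLoad_mem_wardrop hΓφ hP (fun n => hσ (φ n)) hy, φ, tendsto_esc hΓφ hP hy⟩

theorem wardrop_limitGame_nonempty (hΓ : AsymptoticallyPoisson Γ d) (hP : PoissonMoment G d) :
    (limitGame G d).wardrop.Nonempty := by
  choose σ hσ using fun n => (Γ n).bne_nonempty
  obtain ⟨p, hp, -⟩ := exists_subseq_tendsto_esc hΓ hP hσ
  exact ⟨p, hp⟩

omit [DecidableEq T] in
theorem socialCost_eq_eqCost (hP : PoissonMoment G d) {p : (limitGame G d).FlowLoad}
    (hp : p ∈ (limitGame G d).wardrop) :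
    (limitGame G d).socialCost p = (limitGame G d).eqCost := by
  have h : (limitGame G d).socialCost '' (limitGame G d).wardrop =
      {(limitGame G d).socialCost p} := by
    refine Set.eq_singleton_iff_unique_mem.2 ⟨⟨p, hp, rfl⟩, ?_⟩
    rintro _ ⟨q, hq, rfl⟩
    exact NonatomicGame.socialCost_eq_of_mem_wardrop G.strat_nonempty hP.monotoneOn_auxCost hq hp
  rw [NonatomicGame.eqCost, h, csSup_singleton]

theorem tendsto_esc_of_mem_bne (hΓ : AsymptoticallyPoisson Γ d) (hP : PoissonMoment G d)
    {σ : ∀ n, (Γ n).Profile} (hσ : ∀ n, σ n ∈ (Γ n).bne) :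
    Tendsto (fun n => (Γ n).esc (σ n)) atTop (𝓝 (limitGame G d).eqCost) := by
  refine tendsto_of_subseq_tendsto fun ns hns => ?_
  obtain ⟨p, hp, φ, h⟩ := exists_subseq_tendsto_esc (hΓ.comp hns) hP fun n => hσ (ns n)
  rw [socialCost_eq_eqCost hP hp] at h
  exact ⟨φ, h⟩

theorem image_wardrop_div_opt (hΓ : AsymptoticallyPoisson Γ d) (hP : PoissonMoment G d) :
    (fun p => (limitGame G d).socialCost p / (limitGame G d).opt) '' (limitGame G d).wardrop =
      {(limitGame G d).eqCost / (limitGame G d).opt} := by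
  obtain ⟨p, hp⟩ := wardrop_limitGame_nonempty hΓ hP
  refine Set.eq_singleton_iff_unique_mem.2
    ⟨⟨p, hp, by simp only [socialCost_eq_eqCost hP hp]⟩, ?_⟩
  rintro _ ⟨q, hq, rfl⟩
  simp only [socialCost_eq_eqCost hP hq]

theorem poa_limitGame (hΓ : AsymptoticallyPoisson Γ d) (hP : PoissonMoment G d) :
    (limitGame G d).poa = (limitGame G d).eqCost / (limitGame G d).opt := by
  rw [NonatomicGame.poa, image_wardrop_div_opt hΓ hP, csSup_singleton]

theorem pos_limitGame (hΓ : AsymptoticallyPoisson Γ d) (hP : PoissonMoment G d) :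
    (limitGame G d).pos = (limitGame G d).eqCost / (limitGame G d).opt := by
  rw [NonatomicGame.pos, image_wardrop_div_opt hΓ hP, csInf_singleton]

/-- Ratios attained by equilibria converge to the price of anarchy of the limit game. -/
theorem tendsto_ratio (hΓ : AsymptoticallyPoisson Γ d) (hP : PoissonMoment G d)
    (hopt : 0 < (limitGame G d).opt) {r : ℕ → ℝ}
    (hr : ∀ n, r n ∈ (fun σ => (Γ n).esc σ / (Γ n).opt) '' (Γ n).bne) :
    Tendsto r atTop (𝓝 (limitGame G d).poa) := by
  choose σ hσ hσr using hr
  rw [poa_limitGame hΓ hP, ← funext hσr]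
  exact (tendsto_esc_of_mem_bne hΓ hP hσ).div (tendsto_opt hΓ hP) hopt.ne'

end Convergence

end Congestion

theorem mainTheorem8 {E : Type*} {T : Type*} [Fintype E] [DecidableEq E] [Fintype T]
    [DecidableEq T] (G : Congestion.Structure E T) (Γ : ℕ → Congestion.BernoulliGame G)
    (d : T → ℝ) (hΓ : Congestion.AsymptoticallyPoisson Γ d) (hP : Congestion.PoissonMoment G d) :
    -- The auxiliary costs are finite at all loads that can occur in the limit game.
    (∀ e, ∀ x ∈ Set.Icc 0 (∑ t, d t),
      Integrable (fun k => G.cost e (1 + k)) (poissonMeasure x.toNNReal)) ∧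
    -- The limit game has an optimum and a Wardrop equilibrium, and its equilibria have equal cost.
    IsLeast ((Congestion.limitGame G d).socialCost '' (Congestion.limitGame G d).feasible)
      (Congestion.limitGame G d).opt ∧
    (Congestion.limitGame G d).wardrop.Nonempty ∧
    (∀ p ∈ (Congestion.limitGame G d).wardrop,
      (Congestion.limitGame G d).socialCost p = (Congestion.limitGame G d).eqCost) ∧
    -- In the Bernoulli games, the extrema that define Opt, PoA and PoS are attained.
    (∀ n, IsLeast (Set.range (Γ n).esc) (Γ n).opt ∧
      IsGreatest ((fun σ => (Γ n).esc σ / (Γ n).opt) '' (Γ n).bne) (Γ n).poa ∧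
      IsLeast ((fun σ => (Γ n).esc σ / (Γ n).opt) '' (Γ n).bne) (Γ n).pos) ∧
    -- Convergence of equilibrium costs, of optimal costs, and of PoA and PoS.
    (∀ σ : (n : ℕ) → (Γ n).Profile, (∀ n, σ n ∈ (Γ n).bne) →
      Tendsto (fun n => (Γ n).esc (σ n)) atTop (𝓝 (Congestion.limitGame G d).eqCost)) ∧
    Tendsto (fun n => (Γ n).opt) atTop (𝓝 (Congestion.limitGame G d).opt) ∧
    (0 < (Congestion.limitGame G d).opt →
      (Congestion.limitGame G d).poa =
        (Congestion.limitGame G d).eqCost / (Congestion.limitGame G d).opt ∧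
      (Congestion.limitGame G d).pos = (Congestion.limitGame G d).poa ∧
      Tendsto (fun n => (Γ n).poa) atTop (𝓝 (Congestion.limitGame G d).poa) ∧
      Tendsto (fun n => (Γ n).pos) atTop (𝓝 (Congestion.limitGame G d).poa)) :=
  ⟨fun e _ hx => hP.integrable_cost e hx.2,
    Congestion.isLeast_limitGame_opt hΓ hP,
    Congestion.wardrop_limitGame_nonempty hΓ hP,
    fun _ hp => Congestion.socialCost_eq_eqCost hP hp,
    fun n => ⟨(Γ n).isLeast_opt, (Γ n).isGreatest_poa, (Γ n).isLeast_pos⟩,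
    fun _ hσ => Congestion.tendsto_esc_of_mem_bne hΓ hP hσ,
    Congestion.tendsto_opt hΓ hP,
    fun hopt => ⟨Congestion.poa_limitGame hΓ hP,
      (Congestion.pos_limitGame hΓ hP).trans (Congestion.poa_limitGame hΓ hP).symm,
      -- Both extrema are attained, so each is a sequence of ratios at equilibria.
      Congestion.tendsto_ratio hΓ hP hopt fun n => (Γ n).isGreatest_poa.1,
      Congestion.tendsto_ratio hΓ hP hopt fun n => (Γ n).isLeast_pos.1⟩⟩
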